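/- Let $K$ be any field with algebraic closure $\overline K$, and let $E/K$ be an elliptic curve or, more generally, any abelian variety (a proper geometrically integral group scheme over $K$). For an extension $L/K$, a point $P\in E(L)$ is called *new over $L$* if it does not belong to $E(F)$ for any proper subfield $K\subseteq F\subsetneq L$. For $P \in E(L)$, let $K(P)\subseteq L$ denote the field generated over $K$ by the coordinates of $P$ (the image in $L$ of the residue field of the point of $E$ determined by $P$). (1) Let $L_1/K$ and $L_2/K$ be two extensions contained in $\overline K$ with $L_1\not\subseteq L_2$ and $L_2\not\subseteq L_1$, and let $L:=L_1L_2$. Let $P\in E(L_1)$ be a new point over $L_1$ and $Q\in E(L_2)$ a new point over $L_2$, and consider $P+Q\in E(L)$. - (a) $K(P+Q)$ is contained neither in $L_1$ nor in $L_2$. - (b) If $L_1$ and $L_2$ are linearly disjoint over $K$, then $[K(P+Q):K]\ge\max\{[L_1:K],[L_2:K]\}$. - (c) Assume that $L_1/K$ and $L_2/K$ are Galois and linearly disjoint over $K$. Let $e(L_i/K)$ be the exponent of $\mathrm{Gal}(L_i/K)$ and $e:=\gcd(e(L_1/K),e(L_2/K))$. If $E(K)$ contains no non-trivial torsion point of order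 dividing $e$ (which always holds if $e=1$), then $P+Q$ is a new point over $L$. (2) Assume that $K$ is a number field and that $E(K)$ contains a point of prime order $p$. Then there exists a finite set $S$ of Galois extensions of $K$ in $\overline K$, depending only on $K$, $E$ and $p$, such that for all distinct cyclic extensions $L_1, L_2$ of $K$ in $\overline K$ of degree $p$ with $L_1,L_2\notin S$, and all points $P\in E(L_1)$ new over $L_1$ and $Q\in E(L_2)$ new over $L_2$, the point $P+Q\in E(L_1L_2)$ is a new point over $L_1L_2$. -/

import Mathlib

open CategoryTheory AlgebraicGeometry

open scoped MonObj

universe u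

noncomputable section

namespace NewPoint

variable {K : Type u} [Field K]

/-- `Spec F` as a `K`-scheme, for an extension field `F` of `K`. -/
abbrev specOver (K : Type u) [Field K] (F : Type u) [Field F] [Algebra K F] :
    Over (Spec (.of K)) :=
  Over.mk (Spec.map (CommRingCat.ofHom (algebraMap K F)))

/-- The set `E(F)` of `F`-valued points of a `K`-scheme `E`, that is, of `K`-morphisms
`Spec F ⟶ E`. It is written additively: if `E` is a group scheme over `K`, the group structure
is the one that the functor of points puts on `Spec F ⟶ E`. -/
abbrev Points (E : Over (Spec (.of K))) (F : Type u) [Field F] [Algebra K F] : Type u :=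
  Additive (specOver K F ⟶ E)

/-- The morphism of `K`-schemes `Spec F' ⟶ Spec F` induced by a `K`-embedding `F → F'`. -/
def specMap {F F' : Type u} [Field F] [Field F'] [Algebra K F] [Algebra K F'] (f : F →ₐ[K] F') :
    specOver K F' ⟶ specOver K F :=
  Over.homMk (Spec.map (CommRingCat.ofHom f.toRingHom)) (by
    simp only [Over.mk_left, Over.mk_hom, ← Spec.map_comp, ← CommRingCat.ofHom_comp]
    congr 2
    exact f.comp_algebraMap)

/-- The map `E(F) → E(F')` induced by a `K`-embedding `F → F'`. -/
def baseChange {E : Over (Spec (.of K))} {F F' : Type u} [Field F] [Field F'] [Algebra K F]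
    [Algebra K F'] (f : F →ₐ[K] F') (P : Points E F) : Points E F' :=
  Additive.ofMul (specMap f ≫ P.toMul)

/-- A point of `E(L)` is new if it does not come from `E(F)` for any proper subfield `F` of `L`
containing `K`. -/
def IsNew {E : Over (Spec (.of K))} {L : Type u} [Field L] [Algebra K L] (P : Points E L) : Prop :=
  ∀ F : IntermediateField K L, F ≠ ⊤ → ∀ P₀ : Points E F, baseChange F.val P₀ ≠ P

/-- The subfield `K(P)` of `L` generated over `K` by the coordinates of `P ∈ E(L)`: if `x` is the
image point of `P : Spec L ⟶ E`, it is the image of the residue field of `E` at `x` in `L`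
under the embedding that corresponds to `P`. -/
def coordField {E : Over (Spec (.of K))} {L : Type u} [Field L] [Algebra K L] (P : Points E L) :
    IntermediateField K L :=
  IntermediateField.adjoin K
    (Set.range (Scheme.SpecToEquivOfField L E.left P.toMul.left).2.hom)

/-- The sum `P + Q`, in `E(L₁L₂)`, of points `P ∈ E(L₁)` and `Q ∈ E(L₂)` over two subfields
`L₁`, `L₂` of an extension `Ω` of `K`. -/
def addCompositum {E : Over (Spec (.of K))} [GrpObj E] {Ω : Type u} [Field Ω] [Algebra K Ω]
    {L₁ L₂ : IntermediateField K Ω} (P : Points E L₁) (Q : Points E L₂) :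
    Points E ↥(L₁ ⊔ L₂) :=
  baseChange (IntermediateField.inclusion le_sup_left) P +
    baseChange (IntermediateField.inclusion le_sup_right) Q

/-- `E(K)` has no non-trivial torsion point of order dividing `e`. -/
def NoTorsionDividing (E : Over (Spec (.of K))) [GrpObj E] (e : ℕ) : Prop :=
  ∀ T : Points E K, addOrderOf T ∣ e → T = 0

end NewPoint

end

/-!
Let `K(X)` denote the field generated by the coordinates of a point `X`. A point comes from a
subfield `F` exactly if `K(X) ⊆ F` (`exists_baseChange_eq_iff`), so `P ∈ E(L)` is new if and
only if `K(P) = L`, and the group law is defined over `K`, so `K(X + Y) ⊆ K(X) K(Y)`. Applied to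
`P = (P + Q) - Q` and `Q = -P + (P + Q)` this says that `L₁ ⊆ L₂ K(P + Q)` and
`L₂ ⊆ L₁ K(P + Q)`. The statement about inclusions follows at once, and the one about degrees
follows because `[L₂ : K] = [L₁ L₂ : L₁] ≤ [K(P + Q) : K]` for linearly disjoint `L₁`, `L₂`
(`rank_le_of_le_sup`), and symmetrically.

Let `L₁`, `L₂` be Galois with intersection `K`. If `P + Q` is not new, some automorphism `τ` of
`Kbar` fixes `P + Q` but not all of `L₁ L₂`. Then `T = τ P - P = Q - τ Q` has coordinates in
`L₁ ∩ L₂ = K` and is nonzero, and iterating `τ P = P + T` shows that `T` is killed by the exponents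
of both Galois groups (`exists_translation_of_coordField_add_ne`).

Over a number field and for `L₁`, `L₂` cyclic of degree `p` this leaves `τ P = P + T` with `T`
nonzero and killed by `p`. Such an `L₁` is unramified outside a finite set of primes of `K` that
depends only on `E` and `p` (`finite_setOf_inertia_moves`), because an inertia group acts trivially
on the residue field and torsion is determined by its reduction. By Hermite's theorem and a bound
for the different there are finitely many such `L₁` (`finite_isGalois_of_inertia_trivial`).

Integral models of `E` are avoided as follows. If inertia moved points by `p`-torsion above
infinitely many primes of `K`, take an ultraproduct `V` of the valuation rings at primes above them.
It is a valuation ring, and it contains `K` since every element of `K` lies in almost all factors. The points `P`, all of which may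
be assumed to lie in one affine chart, give a point with values in the fraction field of `V`. It
extends to `V` by the valuative criterion, since `E` is proper. The reduction map on torsion of
order invertible in `K` is injective over any local `K`-algebra: modulo the square of the ideal of
the origin, multiplication by `n` is scaling by `n` (`eq_zero_of_nsmul_eq_zero_of_residue_eq_zero`).
Hence the inertia elements fix the points `P` for almost all of the chosen primes, a contradiction.
-/

noncomputable section

namespace NewPoint

/-! ### Points with values in `K`-algebras, and affine charts -/

section

variable {K : Type u} [Field K]

/-- `Spec R` as a `K`-scheme, for a `K`-algebra `R`. -/
abbrev affineOver (K : Type u) [Field K] (R : Type u) [CommRing R] [Algebra K R] :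
    Over (Spec (.of K)) :=
  Over.mk (Spec.map (CommRingCat.ofHom (algebraMap K R)))

section AffineOver

variable {R S T : Type u} [CommRing R] [CommRing S] [CommRing T] [Algebra K R] [Algebra K S]
  [Algebra K T]

/-- The morphism of `K`-schemes `Spec S ⟶ Spec R` induced by a `K`-algebra homomorphism
`R → S`. -/
def affineMap (f : R →ₐ[K] S) : affineOver K S ⟶ affineOver K R :=
  Over.homMk (Spec.map (CommRingCat.ofHom f.toRingHom)) (by
    simp only [Over.mk_left, Over.mk_hom, ← Spec.map_comp, ← CommRingCat.ofHom_comp]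
    congr 2
    exact f.comp_algebraMap)

@[simp]
lemma affineMap_left (f : R →ₐ[K] S) :
    (affineMap f).left = Spec.map (CommRingCat.ofHom f.toRingHom) := rfl

lemma affineMap_comp (f : R →ₐ[K] S) (g : S →ₐ[K] T) :
    affineMap (g.comp f) = affineMap g ≫ affineMap f := by
  ext1
  simp only [affineMap_left, Over.comp_left, ← Spec.map_comp, ← CommRingCat.ofHom_comp]
  rfl

lemma affineMap_id : affineMap (AlgHom.id K R) = 𝟙 (affineOver K R) := by
  ext1
  exact Spec.map_id _

lemma affineMap_injective :
    Function.Injective (affineMap : (R →ₐ[K] S) → (affineOver K S ⟶ affineOver K R)) := by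
  intro f g h
  have h' := Spec.map_injective (congrArg (fun m => m.left) h)
  ext x
  exact ConcreteCategory.congr_hom h' x

lemma affineMap_surjective :
    Function.Surjective (affineMap : (R →ₐ[K] S) → (affineOver K S ⟶ affineOver K R)) := by
  intro h
  obtain ⟨φ, hφ⟩ := Spec.map_surjective h.left
  have hw := Over.w h
  simp only [Over.mk_hom] at hw
  rw [← hφ, ← Spec.map_comp, Spec.map_inj] at hw
  refine ⟨⟨φ.hom, fun c => ConcreteCategory.congr_hom hw c⟩, ?_⟩
  ext1
  exact hφ

/-- Two points of a separated scheme with values in a ring `R` agree as soon as they agree in all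
members of a jointly injective family of homomorphisms out of `R`: their equalizer is a closed
subscheme of `Spec R`, cut out by an ideal contained in all the kernels. -/
lemma eq_of_forall_affineMap_comp_eq {X : Over (Spec (.of K))} [IsSeparated X.hom] {J : Type*}
    {R' : J → Type u} [∀ i, CommRing (R' i)] [∀ i, Algebra K (R' i)] (f : ∀ i, R →ₐ[K] R' i)
    (hf : ∀ x, (∀ i, f i x = 0) → x = 0) {P Q : affineOver K R ⟶ X}
    (h : ∀ i, affineMap (f i) ≫ P = affineMap (f i) ≫ Q) : P = Q := by
  obtain ⟨I, e, he⟩ := IsClosedImmersion.Spec_iff.mp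
    (inferInstance : IsClosedImmersion (Limits.equalizer.ι P Q).left)
  have hI : I = ⊥ := by
    refine le_bot_iff.mp fun x hx => hf x fun i => ?_
    have h1 : (Limits.equalizer.lift _ (h i)).left ≫ (Limits.equalizer.ι P Q).left =
        Spec.map (CommRingCat.ofHom (f i).toRingHom) := by
      rw [← Over.comp_left, Limits.equalizer.lift_ι, affineMap_left]
    rw [he, ← Category.assoc] at h1
    obtain ⟨φ, hφ⟩ := Spec.map_surjective ((Limits.equalizer.lift _ (h i)).left ≫ e.hom)
    rw [← hφ, ← Spec.map_comp, Spec.map_inj] at h1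
    have h2 := ConcreteCategory.congr_hom h1 x
    refine h2.symm.trans ?_
    simp [Ideal.Quotient.eq_zero_iff_mem.mpr hx]
  have : IsIso (Limits.equalizer.ι P Q).left := by
    subst hI
    rw [he]
    have : IsIso (CommRingCat.ofHom (Ideal.Quotient.mk (⊥ : Ideal R))) :=
      (ConcreteCategory.isIso_iff_bijective _).mpr
        ⟨by
          rw [injective_iff_map_eq_zero]
          intro a ha
          simpa using Ideal.Quotient.eq_zero_iff_mem.mp ha, Ideal.Quotient.mk_surjective⟩
    infer_instance
  ext1
  rw [← cancel_epi (Limits.equalizer.ι P Q).left]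
  exact congrArg (fun m => m.left) (Limits.equalizer.condition P Q)

lemma eq_of_affineMap_comp_eq {X : Over (Spec (.of K))} [IsSeparated X.hom] (f : R →ₐ[K] S)
    (hf : Function.Injective f) {P Q : affineOver K R ⟶ X}
    (h : affineMap f ≫ P = affineMap f ≫ Q) : P = Q :=
  eq_of_forall_affineMap_comp_eq (J := Unit) (fun _ => f)
    (fun x hx => hf (by rw [hx (), map_zero])) (fun _ => h)

end AffineOver

section Charts

/-- An affine chart of a `K`-scheme `X`: an open immersion `Spec B ⟶ X` of `K`-schemes, where `B`
is a finitely generated `K`-algebra. -/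
structure Chart (X : Over (Spec (.of K))) where
  /-- The coordinate ring of the chart. -/
  ring : Type u
  [commRing : CommRing ring]
  [algebra : Algebra K ring]
  [finiteType : Algebra.FiniteType K ring]
  /-- The open immersion onto the chart. -/
  emb : affineOver K ring ⟶ X
  [isOpenImmersion : IsOpenImmersion emb.left]

attribute [instance] Chart.commRing Chart.algebra Chart.finiteType Chart.isOpenImmersion

variable {X : Over (Spec (.of K))}

lemma exists_chart [LocallyOfFiniteType X.hom] (x : X.left) :
    ∃ c : Chart X, x ∈ Set.range c.emb.left := by
  let 𝒰 := X.left.affineOpenCover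
  obtain ⟨φ, hφ⟩ := Spec.map_surjective (𝒰.f (𝒰.idx x) ≫ X.hom)
  let alg : Algebra K (𝒰.X (𝒰.idx x)) := φ.hom.toAlgebra
  have hfin : Algebra.FiniteType K (𝒰.X (𝒰.idx x)) := by
    have h : LocallyOfFiniteType (Spec.map φ) := by rw [hφ]; infer_instance
    rwa [HasRingHomProperty.Spec_iff (P := @LocallyOfFiniteType)] at h
  exact ⟨@Chart.mk K _ X (𝒰.X (𝒰.idx x)) _ alg hfin (Over.homMk (𝒰.f (𝒰.idx x)) hφ.symm)
    (𝒰.map_prop (𝒰.idx x)), 𝒰.covers x⟩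

/-- A point of `X` whose image lies in a chart is given by a homomorphism out of the coordinate
ring of the chart. -/
lemma Chart.exists_affineMap_comp_emb_eq (c : Chart X) {R : Type u} [CommRing R] [Algebra K R]
    (P : affineOver K R ⟶ X) (h : Set.range P.left ⊆ Set.range c.emb.left) :
    ∃ φ : c.ring →ₐ[K] R, affineMap φ ≫ c.emb = P := by
  let l : affineOver K R ⟶ affineOver K c.ring :=
    Over.homMk (IsOpenImmersion.lift c.emb.left P.left h) (by
      rw [← Over.w c.emb, IsOpenImmersion.lift_fac_assoc, Over.w])
  obtain ⟨φ, hφ⟩ := affineMap_surjective l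
  refine ⟨φ, ?_⟩
  rw [hφ]
  ext1
  exact IsOpenImmersion.lift_fac ..

/-- A point with values in a local ring lies in every chart that contains the image of the closed
point. -/
lemma Chart.exists_affineMap_comp_emb_eq_of_isLocalRing (c : Chart X) {R : Type u} [CommRing R]
    [Algebra K R] [IsLocalRing R] (P : affineOver K R ⟶ X)
    (h : P.left (IsLocalRing.closedPoint R) ∈ Set.range c.emb.left) :
    ∃ φ : c.ring →ₐ[K] R, affineMap φ ≫ c.emb = P := by
  refine c.exists_affineMap_comp_emb_eq P ?_
  rintro _ ⟨x, rfl⟩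
  exact ((IsLocalRing.specializes_closedPoint x).map P.left.continuous).mem_open
    c.emb.left.opensRange.2 h

lemma Chart.affineMap_comp_emb_injective (c : Chart X) {R : Type u} [CommRing R] [Algebra K R]
    {φ ψ : c.ring →ₐ[K] R} (h : affineMap φ ≫ c.emb = affineMap ψ ≫ c.emb) : φ = ψ := by
  refine affineMap_injective ?_
  ext1
  rw [← cancel_mono c.emb.left]
  exact congrArg (fun m => m.left) h

end Charts

end

section

variable {K : Type u} [Field K]

section RingPoints

variable {E : Over (Spec (.of K))} {R S T : Type u} [CommRing R] [CommRing S] [CommRing T]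
  [Algebra K R] [Algebra K S] [Algebra K T]

/-- The set `E(R)` of points of `E` with values in a `K`-algebra `R`. For a field `R` it is
definitionally `Points E R`. -/
abbrev RingPoints (E : Over (Spec (.of K))) (R : Type u) [CommRing R] [Algebra K R] : Type u :=
  Additive (affineOver K R ⟶ E)

variable [GrpObj E]

/-- The group homomorphism `E(R) → E(S)` induced by a homomorphism `R → S`. For fields it is
definitionally `baseChange`. -/
def pointMap (f : R →ₐ[K] S) : RingPoints E R →+ RingPoints E S where
  toFun P := Additive.ofMul (affineMap f ≫ P.toMul)
  map_zero' := congrArg Additive.ofMul (MonObj.comp_one (affineMap f))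
  map_add' P Q := congrArg Additive.ofMul (MonObj.comp_mul (affineMap f) P.toMul Q.toMul)

lemma pointMap_comp (g : S →ₐ[K] T) (f : R →ₐ[K] S) (P : RingPoints E R) :
    pointMap (g.comp f) P = pointMap g (pointMap f P) :=
  congrArg Additive.ofMul (by rw [affineMap_comp, Category.assoc]; rfl)

@[simp]
lemma pointMap_id (P : RingPoints E R) : pointMap (AlgHom.id K R) P = P :=
  congrArg Additive.ofMul (show affineMap (AlgHom.id K R) ≫ P.toMul = P.toMul by
    rw [affineMap_id, Category.id_comp])

lemma eq_of_forall_pointMap_eq [IsSeparated E.hom] {J : Type*} {R' : J → Type u}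
    [∀ i, CommRing (R' i)] [∀ i, Algebra K (R' i)] (f : ∀ i, R →ₐ[K] R' i)
    (hf : ∀ x, (∀ i, f i x = 0) → x = 0) {P Q : RingPoints E R}
    (h : ∀ i, pointMap (f i) P = pointMap (f i) Q) : P = Q :=
  congrArg Additive.ofMul (eq_of_forall_affineMap_comp_eq f hf (P := P.toMul) (Q := Q.toMul)
    fun i => congrArg Additive.toMul (h i))

lemma pointMap_injective [IsSeparated E.hom] (f : R →ₐ[K] S) (hf : Function.Injective f) :
    Function.Injective (pointMap f : RingPoints E R →+ RingPoints E S) := fun P Q h =>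
  congrArg Additive.ofMul (eq_of_affineMap_comp_eq f hf (P := P.toMul) (Q := Q.toMul)
    (congrArg Additive.toMul h))

end RingPoints

/-! ### First-order deformations of zero and reduction of torsion points -/

section Scaling

variable {C : Type u} [CommRing C] [Algebra K C] (ε : C →ₐ[K] K)
  (hε : ∀ a b, ε a = 0 → ε b = 0 → a * b = 0)

/-- If the augmentation ideal `I` of a `K`-algebra `C = K ⊕ I` has square zero, multiplication by
a scalar on `I` extends to an endomorphism of the algebra `C`. -/
def scaling (c : K) : C →ₐ[K] C :=
  AlgHom.ofLinearMap ((Algebra.linearMap K C).comp ε.toLinearMap +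
      c • (LinearMap.id - (Algebra.linearMap K C).comp ε.toLinearMap))
    (by simp) (by
      intro a b
      have h := hε (a - algebraMap K C (ε a)) (b - algebraMap K C (ε b)) (by simp) (by simp)
      simp only [LinearMap.add_apply, LinearMap.comp_apply, AlgHom.toLinearMap_apply,
        Algebra.linearMap_apply, LinearMap.smul_apply, LinearMap.sub_apply, LinearMap.id_apply,
        map_mul]
      simp only [Algebra.smul_def]
      linear_combination (algebraMap K C c - (algebraMap K C c) ^ 2) * h)

lemma scaling_apply (c : K) (a : C) :
    scaling ε hε c a = algebraMap K C (ε a) + c • (a - algebraMap K C (ε a)) := rfl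

lemma augmentation_scaling (c : K) (a : C) : ε (scaling ε hε c a) = ε a := by
  simp [scaling_apply]

/-- Scaling of first-order deformations of zero is additive in the scalar. Both sides come from
the points of `E` with values in the fibre product `C ×_K C`, where equality can be tested on the
two projections, along the homomorphism `C ×_K C → C` that adds the two augmentation parts. -/
lemma pointMap_scaling_add {E : Over (Spec (.of K))} [GrpObj E] [IsSeparated E.hom]
    (t : RingPoints E C) (ht : pointMap ε t = 0) (c d : K) :
    pointMap (scaling ε hε (c + d)) t =
      pointMap (scaling ε hε c) t + pointMap (scaling ε hε d) t := by
  let W : Subalgebra K (C × C) :=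
    AlgHom.equalizer (ε.comp (AlgHom.fst K C C)) (ε.comp (AlgHom.snd K C C))
  let aug : C →ₐ[K] C := (Algebra.ofId K C).comp ε
  have haug : pointMap aug t = 0 := by rw [pointMap_comp, ht, map_zero]
  let p₁ : W →ₐ[K] C := (AlgHom.fst K C C).comp W.val
  let p₂ : W →ₐ[K] C := (AlgHom.snd K C C).comp W.val
  let sum : W →ₐ[K] C := AlgHom.ofLinearMap (p₁.toLinearMap + p₂.toLinearMap -
      (Algebra.linearMap K C).comp (ε.comp p₁).toLinearMap) (by simp [p₁, p₂]) (by
    rintro ⟨⟨a, a'⟩, ha⟩ ⟨⟨b, b'⟩, hb⟩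
    replace ha : ε a = ε a' := ha
    replace hb : ε b = ε b' := hb
    have h1 := hε (a - algebraMap K C (ε a)) (b' - algebraMap K C (ε b)) (by simp) (by simp [hb])
    have h2 := hε (a' - algebraMap K C (ε a)) (b - algebraMap K C (ε b)) (by simp [ha]) (by simp)
    simp only [LinearMap.add_apply, LinearMap.sub_apply, LinearMap.comp_apply,
      AlgHom.toLinearMap_apply, AlgHom.comp_apply, Algebra.linearMap_apply, map_mul, p₁, p₂,
      Subalgebra.val_apply, AlgHom.fst_apply, AlgHom.snd_apply]
    linear_combination - h1 - h2)
  let inl : C →ₐ[K] W := ((AlgHom.id K C).prod aug).codRestrict W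
    (fun a => by simp [W, aug, Algebra.ofId_apply])
  let inr : C →ₐ[K] W := (aug.prod (AlgHom.id K C)).codRestrict W
    (fun a => by simp [W, aug, Algebra.ofId_apply])
  let both : C →ₐ[K] W := ((scaling ε hε c).prod (scaling ε hε d)).codRestrict W
    (fun a => by simp [W, augmentation_scaling])
  have hboth : pointMap both t =
      pointMap inl (pointMap (scaling ε hε c) t) + pointMap inr (pointMap (scaling ε hε d) t) := by
    refine eq_of_forall_pointMap_eq (J := Bool) (fun b => cond b p₁ p₂) ?_ ?_
    · intro w hw
      ext1
      exact Prod.ext (hw true) (hw false)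
    · rintro (_ | _)
      · simp only [cond_false, map_add, ← pointMap_comp]
        have e1 : p₂.comp both = scaling ε hε d := rfl
        have e2 : p₂.comp (inr.comp (scaling ε hε d)) = scaling ε hε d := rfl
        have e3 : p₂.comp (inl.comp (scaling ε hε c)) = aug := by
          ext a
          exact congrArg (algebraMap K C) (augmentation_scaling ε hε c a)
        simp only [e1, e2, e3, haug, zero_add]
      · simp only [cond_true, map_add, ← pointMap_comp]
        have e1 : p₁.comp both = scaling ε hε c := rfl
        have e2 : p₁.comp (inl.comp (scaling ε hε c)) = scaling ε hε c := rfl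
        have e3 : p₁.comp (inr.comp (scaling ε hε d)) = aug := by
          ext a
          exact congrArg (algebraMap K C) (augmentation_scaling ε hε d a)
        simp only [e1, e2, e3, haug, add_zero]
  have h := congrArg (pointMap sum) hboth
  simp only [map_add, ← pointMap_comp] at h
  have e1 : sum.comp both = scaling ε hε (c + d) := by
    ext a
    change scaling ε hε c a + scaling ε hε d a - algebraMap K C (ε (scaling ε hε c a)) = _
    rw [augmentation_scaling]
    simp only [scaling_apply, add_smul]
    ring
  have e2 : sum.comp (inl.comp (scaling ε hε c)) = scaling ε hε c := by
    ext a
    change scaling ε hε c a + algebraMap K C (ε (scaling ε hε c a)) -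
      algebraMap K C (ε (scaling ε hε c a)) = _
    ring
  have e3 : sum.comp (inr.comp (scaling ε hε d)) = scaling ε hε d := by
    ext a
    change algebraMap K C (ε (scaling ε hε d a)) + scaling ε hε d a -
      algebraMap K C (ε (algebraMap K C (ε (scaling ε hε d a)))) = _
    simp
  simpa only [AlgHom.comp_assoc, e1, e2, e3] using h

lemma pointMap_scaling_natCast {E : Over (Spec (.of K))} [GrpObj E] [IsSeparated E.hom]
    (t : RingPoints E C) (ht : pointMap ε t = 0) (n : ℕ) :
    pointMap (scaling ε hε n) t = n • t := by
  have h0 : scaling ε hε 0 = (Algebra.ofId K C).comp ε := by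
    ext a
    simp [scaling_apply, Algebra.ofId_apply]
  have h1 : scaling ε hε 1 = AlgHom.id K C := by
    ext a
    simp [scaling_apply]
  induction n with
  | zero => rw [Nat.cast_zero, h0, pointMap_comp, ht, map_zero, zero_smul]
  | succ n ih =>
    rw [Nat.cast_succ, pointMap_scaling_add ε hε t ht, ih, h1, pointMap_id, succ_nsmul]

end Scaling

section TorsionReduction

open IsLocalRing

/-- A torsion point of order prime to the characteristic, with values in a local `K`-algebra `O`,
vanishes if it vanishes in the residue field. In coordinates at the origin let `J` be the ideal
of `O` generated by the coordinates of the point. Modulo `J ^ 2` multiplication by `n` acts on the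
coordinates as scaling by `n`, so that `J = J ^ 2`, and `J = 0` by Nakayama's lemma. -/
theorem eq_zero_of_nsmul_eq_zero_of_residue_eq_zero {E : Over (Spec (.of K))} [GrpObj E]
    [IsSeparated E.hom] [LocallyOfFiniteType E.hom] {O : Type u} [CommRing O] [IsLocalRing O]
    [Algebra K O] {n : ℕ} (hn : (n : K) ≠ 0) (t : RingPoints E O) (hnt : n • t = 0)
    (ht : pointMap (IsScalarTower.toAlgHom K O (ResidueField O)) t = 0) : t = 0 := by
  let z : RingPoints E K := 0
  obtain ⟨c, hc⟩ := exists_chart (X := E) (z.toMul.left (closedPoint K))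
  let e : c.ring →ₐ[K] K :=
    (c.exists_affineMap_comp_emb_eq_of_isLocalRing z.toMul hc).choose
  have he : affineMap e ≫ c.emb = z.toMul :=
    (c.exists_affineMap_comp_emb_eq_of_isLocalRing z.toMul hc).choose_spec
  have hz : ∀ (R : Type u) [CommRing R] [Algebra K R],
      affineMap ((Algebra.ofId K R).comp e) ≫ c.emb = (0 : RingPoints E R).toMul := by
    intro R _ _
    rw [affineMap_comp, Category.assoc, he]
    exact congrArg Additive.toMul (map_zero (pointMap (E := E) (Algebra.ofId K R)))
  set ρ := IsScalarTower.toAlgHom K O (ResidueField O)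
  obtain ⟨φ, hφ⟩ := c.exists_affineMap_comp_emb_eq_of_isLocalRing t.toMul (by
    have h : affineMap ρ ≫ t.toMul = affineMap (Algebra.ofId K (ResidueField O)) ≫ z.toMul :=
      congrArg Additive.toMul (ht.trans (map_zero (pointMap (Algebra.ofId K _))).symm)
    have h1 : (affineMap ρ).left (closedPoint (ResidueField O)) = closedPoint O :=
      comap_closedPoint (residue O)
    have h2 : (affineMap (Algebra.ofId K (ResidueField O))).left (closedPoint (ResidueField O)) =
        closedPoint K := Subsingleton.elim (α := PrimeSpectrum K) _ _
    have h3 : t.toMul.left (closedPoint O) = z.toMul.left (closedPoint K) :=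
      (congrArg t.toMul.left h1).symm.trans ((congrArg
        (fun m => m.left (closedPoint (ResidueField O))) h).trans (congrArg z.toMul.left h2))
    exact h3 ▸ hc)
  have hρφ : ρ.comp φ = (Algebra.ofId K _).comp e := by
    apply c.affineMap_comp_emb_injective
    rw [hz, affineMap_comp, Category.assoc, hφ]
    exact congrArg Additive.toMul ht
  have hmem : ∀ b, e b = 0 → φ b ∈ maximalIdeal O := by
    intro b hb
    have := congrArg (fun f => f b) hρφ
    simp only [AlgHom.comp_apply, hb, map_zero] at this
    exact (residue_eq_zero_iff _).mp this
  let m : Ideal c.ring := RingHom.ker e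
  let J : Ideal O := m.map φ
  have hJm : J ≤ maximalIdeal O := Ideal.map_le_iff_le_comap.mpr fun b hb => hmem b hb
  let C := c.ring ⧸ m ^ 2
  let ε : C →ₐ[K] K := Ideal.Quotient.liftₐ (m ^ 2) e
    (fun a ha => Ideal.pow_le_self two_ne_zero ha)
  have hε : ∀ a b, ε a = 0 → ε b = 0 → a * b = 0 := by
    intro a b
    obtain ⟨a, rfl⟩ := Ideal.Quotient.mk_surjective a
    obtain ⟨b, rfl⟩ := Ideal.Quotient.mk_surjective b
    intro ha hb
    rw [← map_mul, Ideal.Quotient.eq_zero_iff_mem, pow_two]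
    exact Ideal.mul_mem_mul ha hb
  let π : c.ring →ₐ[K] C := Ideal.Quotient.mkₐ K (m ^ 2)
  let u : RingPoints E C := Additive.ofMul (affineMap π ≫ c.emb)
  have hu : pointMap ε u = 0 := by
    refine congrArg Additive.ofMul (Eq.trans ?_ he)
    change affineMap ε ≫ affineMap π ≫ c.emb = _
    rw [← Category.assoc, ← affineMap_comp]
    rfl
  let q : O →ₐ[K] O ⧸ J ^ 2 := Ideal.Quotient.mkₐ K (J ^ 2)
  let ψ : C →ₐ[K] O ⧸ J ^ 2 := Ideal.Quotient.liftₐ (m ^ 2) (q.comp φ) (fun a ha => by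
    change Ideal.Quotient.mk (J ^ 2) (φ a) = 0
    rw [Ideal.Quotient.eq_zero_iff_mem]
    have := Ideal.mem_map_of_mem φ ha
    rwa [Ideal.map_pow] at this)
  have hψu : pointMap ψ u = pointMap q t := by
    refine congrArg Additive.ofMul ?_
    change affineMap ψ ≫ affineMap π ≫ c.emb = affineMap q ≫ t.toMul
    rw [← hφ, ← Category.assoc, ← affineMap_comp, ← Category.assoc, ← affineMap_comp]
    rfl
  have hzero : pointMap (ψ.comp (scaling ε hε n)) u = 0 := by
    rw [pointMap_comp, pointMap_scaling_natCast ε hε u hu, map_nsmul, hψu, ← map_nsmul, hnt,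
      map_zero]
  have hcomp : (ψ.comp (scaling ε hε n)).comp π = (Algebra.ofId K _).comp e := by
    apply c.affineMap_comp_emb_injective
    rw [hz, affineMap_comp, Category.assoc]
    exact congrArg Additive.toMul hzero
  have hJ : J ≤ J ^ 2 := by
    refine Ideal.map_le_iff_le_comap.mpr fun b hb => ?_
    have hb' : e b = 0 := hb
    have h := congrArg (fun f => f b) hcomp
    simp only [AlgHom.comp_apply, scaling_apply, map_add, map_smul, hb', map_zero] at h
    have hεb : ε (π b) = 0 := hb'
    rw [hεb] at h
    simp only [map_zero, sub_zero, zero_add, smul_eq_zero, hn, false_or] at h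
    rw [Ideal.mem_comap]
    exact Ideal.Quotient.eq_zero_iff_mem.mp (show Ideal.Quotient.mk (J ^ 2) (φ b) = 0 from h)
  have hJfg : J.FG := by
    have : IsNoetherianRing c.ring := Algebra.FiniteType.isNoetherianRing K c.ring
    exact Ideal.FG.map (IsNoetherian.noetherian m) φ.toRingHom
  have hJbot : J = ⊥ := by
    refine Submodule.eq_bot_of_le_smul_of_le_jacobson_bot (maximalIdeal O) J hJfg ?_
      (jacobson_eq_maximalIdeal ⊥ bot_ne_top).ge
    refine hJ.trans ?_
    rw [pow_two, smul_eq_mul]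
    exact Ideal.mul_mono_left hJm
  have hφe : φ = (Algebra.ofId K O).comp e := by
    ext b
    have : φ (b - algebraMap K c.ring (e b)) ∈ J := Ideal.mem_map_of_mem φ (by simp [m])
    rw [hJbot, Ideal.mem_bot, map_sub, sub_eq_zero] at this
    rw [this]
    simp [Algebra.ofId_apply]
  refine congrArg Additive.ofMul (?_ : t.toMul = (0 : RingPoints E O).toMul)
  rw [← hφ, hφe, hz]

end TorsionReduction

end

/-! ### Ultraproducts of valuation rings -/

section Ultraproduct

open Filter

variable {J : Type u} (F : J → Type u) [∀ i, Field (F i)] (U : Ultrafilter J)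

/-- The ideal of those families that vanish on a set of the ultrafilter `U`. -/
def ultraIdeal : Ideal (∀ i, F i) where
  carrier := {a | ∀ᶠ i in (U : Filter J), a i = 0}
  zero_mem' := Eventually.of_forall fun _ => rfl
  add_mem' ha hb := by
    filter_upwards [ha, hb] with i hi hi'
    simp [hi, hi']
  smul_mem' c a ha := by
    filter_upwards [ha] with i hi
    simp [hi]

lemma mem_ultraIdeal {a : ∀ i, F i} : a ∈ ultraIdeal F U ↔ ∀ᶠ i in (U : Filter J), a i = 0 :=
  Iff.rfl

instance : (ultraIdeal F U).IsMaximal := by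
  refine Ideal.isMaximal_iff.mpr ⟨fun h => ?_, fun I a hI ha haI => ?_⟩
  · obtain ⟨i, hi⟩ := (mem_ultraIdeal F U |>.mp h).exists
    exact one_ne_zero hi
  · have ha' : ∀ᶠ i in (U : Filter J), a i ≠ 0 := Ultrafilter.eventually_not.mpr ha
    have h1 : 1 - a⁻¹ * a ∈ ultraIdeal F U := by
      filter_upwards [ha'] with i hi
      simp [hi]
    have h2 := I.add_mem (hI h1) (I.mul_mem_left a⁻¹ haI)
    simpa using h2

/-- The ultraproduct of a family of fields. -/
abbrev Ultraproduct : Type u := (∀ i, F i) ⧸ ultraIdeal F U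

instance : Field (Ultraproduct F U) := Ideal.Quotient.field _

variable {F U} in
lemma Ultraproduct.mk_eq_zero_iff {a : ∀ i, F i} :
    (Ideal.Quotient.mk (ultraIdeal F U) a) = 0 ↔ ∀ᶠ i in (U : Filter J), a i = 0 :=
  Ideal.Quotient.eq_zero_iff_mem

variable {F U} in
lemma Ultraproduct.mk_inv (a : ∀ i, F i) :
    (Ideal.Quotient.mk (ultraIdeal F U) a)⁻¹ = Ideal.Quotient.mk (ultraIdeal F U) a⁻¹ := by
  by_cases h : Ideal.Quotient.mk (ultraIdeal F U) a = 0
  · rw [h, inv_zero, eq_comm, Ultraproduct.mk_eq_zero_iff]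
    filter_upwards [Ultraproduct.mk_eq_zero_iff.mp h] with i hi
    simp [hi]
  · refine inv_eq_of_mul_eq_one_right ?_
    rw [← map_mul, ← sub_eq_zero, ← map_one (Ideal.Quotient.mk (ultraIdeal F U)), ← map_sub,
      Ultraproduct.mk_eq_zero_iff]
    filter_upwards [Ultrafilter.eventually_not.mpr (mt Ultraproduct.mk_eq_zero_iff.mpr h)]
      with i hi
    simp [hi]

variable (O : ∀ i, ValuationSubring (F i))

/-- The ultraproduct of a family of valuation rings, as a valuation ring of the ultraproduct of
their fields of fractions. -/
def ultraValuationSubring : ValuationSubring (Ultraproduct F U) where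
  carrier := {x | ∃ a : ∀ i, F i, Ideal.Quotient.mk (ultraIdeal F U) a = x ∧
    ∀ᶠ i in (U : Filter J), a i ∈ O i}
  zero_mem' := ⟨0, map_zero _, Eventually.of_forall fun i => (O i).zero_mem⟩
  one_mem' := ⟨1, map_one _, Eventually.of_forall fun i => (O i).one_mem⟩
  add_mem' := by
    rintro _ _ ⟨a, rfl, ha⟩ ⟨b, rfl, hb⟩
    refine ⟨a + b, map_add _ _ _, ?_⟩
    filter_upwards [ha, hb] with i hi hi' using (O i).add_mem _ _ hi hi'
  mul_mem' := by
    rintro _ _ ⟨a, rfl, ha⟩ ⟨b, rfl, hb⟩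
    refine ⟨a * b, map_mul _ _ _, ?_⟩
    filter_upwards [ha, hb] with i hi hi' using (O i).mul_mem _ _ hi hi'
  neg_mem' := by
    rintro _ ⟨a, rfl, ha⟩
    refine ⟨-a, map_neg _ _, ?_⟩
    filter_upwards [ha] with i hi using (O i).neg_mem _ hi
  mem_or_inv_mem' := by
    intro x
    obtain ⟨a, rfl⟩ := Ideal.Quotient.mk_surjective x
    rcases Ultrafilter.em U (fun i => a i ∈ O i) with h | h
    · exact Or.inl ⟨a, rfl, h⟩
    · refine Or.inr ⟨a⁻¹, (Ultraproduct.mk_inv a).symm, ?_⟩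
      filter_upwards [h] with i hi using ((O i).mem_or_inv_mem (a i)).resolve_left hi

variable {F U O} in
lemma mk_mem_ultraValuationSubring {a : ∀ i, F i} :
    Ideal.Quotient.mk (ultraIdeal F U) a ∈ ultraValuationSubring F U O ↔
      ∀ᶠ i in (U : Filter J), a i ∈ O i := by
  refine ⟨?_, fun h => ⟨a, rfl, h⟩⟩
  rintro ⟨b, hb, h⟩
  rw [← sub_eq_zero, ← map_sub, Ultraproduct.mk_eq_zero_iff] at hb
  filter_upwards [hb, h] with i hi hi'
  rwa [← sub_eq_zero.mp hi]

variable {F U O} in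
/-- A family of elements of the maximal ideals lies in the maximal ideal of the ultraproduct. -/
lemma valuation_ultraValuationSubring_mk_lt_one {a : ∀ i, F i}
    (h : ∀ᶠ i in (U : Filter J), (O i).valuation (a i) < 1) :
    (ultraValuationSubring F U O).valuation (Ideal.Quotient.mk (ultraIdeal F U) a) < 1 := by
  by_contra! hlt
  have ha : Ideal.Quotient.mk (ultraIdeal F U) a ≠ 0 := by
    intro h0
    rw [h0, map_zero] at hlt
    exact not_lt.mpr hlt zero_lt_one
  have hinv : (Ideal.Quotient.mk (ultraIdeal F U) a)⁻¹ ∈ ultraValuationSubring F U O := by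
    rw [← ValuationSubring.valuation_le_one_iff, map_inv₀]
    exact inv_le_one_of_one_le₀ hlt
  rw [Ultraproduct.mk_inv, mk_mem_ultraValuationSubring] at hinv
  have hne := Ultrafilter.eventually_not.mpr (mt Ultraproduct.mk_eq_zero_iff.mpr ha)
  obtain ⟨i, h1, h2, h3⟩ := (h.and (hinv.and hne)).exists
  rw [← ValuationSubring.valuation_le_one_iff, Pi.inv_apply, map_inv₀] at h2
  have h4 : 0 < (O i).valuation (a i) := by
    rw [zero_lt_iff]
    exact (map_ne_zero _).mpr h3
  exact not_lt.mpr h2 ((one_lt_inv₀ h4).mpr h1)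

end Ultraproduct

/-! ### Torsion translations and valuation rings -/

section Finiteness

open Filter IsLocalRing

variable {K : Type u} [Field K] {E : Over (Spec (.of K))} [GrpObj E] [IsProper E.hom]

/-- Let `V` be a valuation ring of a field `F`, both over `K`, and let `s` be an endomorphism of
`F` that acts trivially on the residue field of `V`. If `E` is proper and `s P - P` is torsion of
order prime to the characteristic, then `s P = P`: by the valuative criterion `P` extends to `V`,
and `s P - P` reduces to zero in the residue field. -/
lemma pointMap_eq_of_nsmul_eq_zero_of_valuationSubring {F : Type u} [Field F] [Algebra K F]
    (V : ValuationSubring F) (hV : ∀ c : K, algebraMap K F c ∈ V) (s : F →ₐ[K] F)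
    (hs : ∀ x ∈ V, V.valuation (s x - x) < 1) {n : ℕ} (hn : (n : K) ≠ 0) (P : RingPoints E F)
    (hP : n • (-P + pointMap s P) = 0) : pointMap s P = P := by
  let _ : Algebra K V := ((algebraMap K F).codRestrict V hV).toAlgebra
  let j : V →ₐ[K] F := { V.subtype with commutes' := fun _ => rfl }
  have hj : Function.Injective j := Subtype.val_injective
  have hsV : ∀ x ∈ V, s x ∈ V := fun x hx => by
    have h := V.add_mem _ _ (V.mem_of_valuation_le_one _ (hs x hx).le) hx
    rwa [sub_add_cancel] at h
  let τ : V →ₐ[K] V :=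
    { (s : F →+* F).restrict V V hsV with
      commutes' := fun c => Subtype.ext (s.commutes c) }
  have hjτ : s.comp j = j.comp τ := rfl
  have hex : ValuativeCriterion.Existence E.hom := by
    have h : UniversallyClosed E.hom := inferInstance
    rw [UniversallyClosed.eq_valuativeCriterion] at h
    exact h.1
  have hsq : CommSq P.toMul.left (Spec.map (CommRingCat.ofHom (algebraMap V F))) E.hom
      (Spec.map (CommRingCat.ofHom (algebraMap K V))) := by
    refine ⟨(Over.w P.toMul).trans ?_⟩
    rw [← Spec.map_comp]
    rfl
  obtain ⟨⟨l, hl, hl'⟩⟩ := (hex { R := V, K := F, i₁ := _, i₂ := _, commSq := hsq }).exists_lift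
  let Q : RingPoints E V := Additive.ofMul (Over.homMk l hl')
  have hQ : pointMap j Q = P := by
    refine congrArg Additive.ofMul (Over.OverMorphism.ext ?_)
    exact hl
  have hT : -Q + pointMap τ Q = 0 := by
    refine eq_zero_of_nsmul_eq_zero_of_residue_eq_zero hn _ ?_ ?_
    · refine pointMap_injective j hj ?_
      rw [map_nsmul, map_add, map_neg, ← pointMap_comp, ← hjτ, pointMap_comp, hQ, hP, map_zero]
    · rw [map_add, map_neg, ← pointMap_comp]
      have : (IsScalarTower.toAlgHom K V (ResidueField V)).comp τ =
          IsScalarTower.toAlgHom K V (ResidueField V) := by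
        ext x
        rw [AlgHom.comp_apply, ← sub_eq_zero, ← map_sub]
        refine (residue_eq_zero_iff _).mpr ?_
        rw [ValuationSubring.valuation_lt_one_iff]
        exact hs x x.2
      rw [this, neg_add_cancel]
  have h := congrArg (pointMap j) hT
  rw [map_add, map_neg, ← pointMap_comp, ← hjτ, pointMap_comp, hQ, map_zero] at h
  exact (neg_add_eq_zero.mp h).symm

variable {J : Type u} (F : J → Type u) [∀ i, Field (F i)] [∀ i, Algebra K (F i)]
  (O : ∀ i, ValuationSubring (F i)) (s : ∀ i, F i →ₐ[K] F i)

/-- The case of `exists_pointMap_eq` in which all points lie in a single affine chart. -/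
lemma exists_pointMap_eq_of_chart [Infinite J]
    (hO : ∀ c : K, {i | algebraMap K (F i) c ∉ O i}.Finite)
    (hs : ∀ i, ∀ x ∈ O i, (O i).valuation (s i x - x) < 1) {n : ℕ} (hn : (n : K) ≠ 0)
    (P : ∀ i, RingPoints E (F i)) (hP : ∀ i, n • (-P i + pointMap (s i) (P i)) = 0)
    (c : Chart E) (hc : ∀ i, (P i).toMul.left (closedPoint (F i)) ∈ Set.range c.emb.left) :
    ∃ i, pointMap (s i) (P i) = P i := by
  choose φ hφ using fun i => c.exists_affineMap_comp_emb_eq_of_isLocalRing (P i).toMul (hc i)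
  let U : Ultrafilter J := Filter.hyperfilter J
  let A := ∀ i, F i
  let Φ : c.ring →ₐ[K] A := AlgHom.pi φ
  let sA : A →ₐ[K] A := AlgHom.pi fun i => (s i).comp (Pi.evalAlgHom K F i)
  let q : A →ₐ[K] Ultraproduct F U := Ideal.Quotient.mkₐ K (ultraIdeal F U)
  have hq : ∀ a, q a = Ideal.Quotient.mk (ultraIdeal F U) a := fun _ => rfl
  let sU : Ultraproduct F U →ₐ[K] Ultraproduct F U :=
    Ideal.Quotient.liftₐ (ultraIdeal F U) (q.comp sA) (fun a ha => by
      rw [AlgHom.comp_apply, hq, Ultraproduct.mk_eq_zero_iff]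
      filter_upwards [ha] with i hi
      change s i (a i) = 0
      rw [hi, map_zero])
  have hsq : sU.comp q = q.comp sA := rfl
  let PA : RingPoints E A := Additive.ofMul (affineMap Φ ≫ c.emb)
  -- `PA` is the family `P`, as a single point with values in the product of the fields `F i`.
  have hev : ∀ i, pointMap (Pi.evalAlgHom K F i) PA = P i := by
    intro i
    refine congrArg Additive.ofMul (Eq.trans ?_ (hφ i))
    change affineMap _ ≫ affineMap Φ ≫ c.emb = _
    rw [← Category.assoc, ← affineMap_comp]
    rfl
  have hPA : n • (-PA + pointMap sA PA) = 0 := by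
    refine eq_of_forall_pointMap_eq (fun i => Pi.evalAlgHom K F i)
      (fun x hx => funext hx) (fun i => ?_)
    have hcomp : (Pi.evalAlgHom K F i).comp sA = (s i).comp (Pi.evalAlgHom K F i) := rfl
    rw [map_nsmul, map_add, map_neg, ← pointMap_comp, hcomp, pointMap_comp, hev, hP, map_zero]
  have hfix : pointMap sU (pointMap q PA) = pointMap q PA := by
    refine pointMap_eq_of_nsmul_eq_zero_of_valuationSubring (ultraValuationSubring F U O) ?_ sU ?_
      hn _ ?_
    · intro a
      change Ideal.Quotient.mk (ultraIdeal F U) (algebraMap K A a) ∈ _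
      rw [mk_mem_ultraValuationSubring]
      filter_upwards [Filter.hyperfilter_le_cofinite (hO a).eventually_cofinite_notMem] with i hi
        using not_not.mp hi
    · intro x hx
      obtain ⟨a, rfl⟩ := Ideal.Quotient.mk_surjective x
      rw [mk_mem_ultraValuationSubring] at hx
      change (ultraValuationSubring F U O).valuation
        (Ideal.Quotient.mk (ultraIdeal F U) (sA a) - Ideal.Quotient.mk (ultraIdeal F U) a) < 1
      rw [← map_sub]
      refine valuation_ultraValuationSubring_mk_lt_one ?_
      filter_upwards [hx] with i hi using hs i _ hi
    · rw [← pointMap_comp, hsq, pointMap_comp, ← map_neg, ← map_add, ← map_nsmul, hPA, map_zero]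
  have hb : ∀ b, ∀ᶠ i in (U : Filter J), s i (φ i b) = φ i b := by
    intro b
    have h1 : (q.comp sA).comp Φ = q.comp Φ := by
      apply c.affineMap_comp_emb_injective
      have h2 := congrArg Additive.toMul hfix
      rw [← pointMap_comp, hsq] at h2
      rw [affineMap_comp, affineMap_comp Φ q, Category.assoc, Category.assoc]
      exact h2
    have h3 := congrArg (fun f => f b) h1
    simp only [AlgHom.comp_apply, hq] at h3
    rw [← sub_eq_zero, ← map_sub, Ultraproduct.mk_eq_zero_iff] at h3
    filter_upwards [h3] with i hi using sub_eq_zero.mp hi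
  -- The coordinate ring has finitely many generators, so one index serves them all.
  obtain ⟨g, hg⟩ := c.finiteType.out
  obtain ⟨i, hi⟩ := ((Filter.eventually_all_finset g).mpr fun b _ => hb b).exists
  refine ⟨i, ?_⟩
  have hsφ : (s i).comp (φ i) = φ i := AlgHom.ext_of_adjoin_eq_top hg fun b hbg => hi b hbg
  refine congrArg Additive.ofMul (?_ : affineMap (s i) ≫ (P i).toMul = (P i).toMul)
  rw [← hφ i, ← Category.assoc, ← affineMap_comp, hsφ]

/-- A Chevalley–Weil type finiteness statement. Given infinitely many valuation rings `O i` of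
extensions `F i` of `K`, such that every element of `K` lies in almost all of them, and
endomorphisms `s i` of `F i` that act trivially on the residue fields, points `P i` such that
`s i (P i) - P i` is killed by `n` cannot all be moved by `s i`. Passing to an ultraproduct turns
the family into a single valuation ring that contains `K`. -/
theorem exists_pointMap_eq [Infinite J]
    (hO : ∀ c : K, {i | algebraMap K (F i) c ∉ O i}.Finite)
    (hs : ∀ i, ∀ x ∈ O i, (O i).valuation (s i x - x) < 1) {n : ℕ} (hn : (n : K) ≠ 0)
    (P : ∀ i, RingPoints E (F i)) (hP : ∀ i, n • (-P i + pointMap (s i) (P i)) = 0) :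
    ∃ i, pointMap (s i) (P i) = P i := by
  choose c hc using exists_chart (X := E)
  have : CompactSpace E.left := QuasiCompact.compactSpace_of_compactSpace E.hom
  obtain ⟨t, ht⟩ := isCompact_univ.elim_finite_subcover
    (fun x => Set.range (c x).emb.left) (fun x => (c x).emb.left.opensRange.2)
    (fun x _ => Set.mem_iUnion.mpr ⟨x, hc x⟩)
  have hcov : ∀ i, ∃ x : t, (P i).toMul.left (closedPoint (F i)) ∈ Set.range (c x).emb.left := by
    intro i
    obtain ⟨x, hx⟩ := Set.mem_iUnion.mp (ht (Set.mem_univ ((P i).toMul.left (closedPoint (F i)))))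
    obtain ⟨hxt, hx⟩ := Set.mem_iUnion.mp hx
    exact ⟨⟨x, hxt⟩, hx⟩
  choose f hf using hcov
  obtain ⟨x, hx⟩ := Finite.exists_infinite_fiber f
  let J' := f ⁻¹' {x}
  obtain ⟨i, hi⟩ := exists_pointMap_eq_of_chart (J := J') (fun i => F i) (fun i => O i)
    (fun i => s i) (fun a => (hO a).preimage Subtype.val_injective.injOn) (fun i => hs i) hn
    (fun i => P i) (fun i => hP i) (c x) (fun i => by
      have h : f i = x := i.2
      exact h ▸ hf i)
  exact ⟨i, hi⟩

end Finiteness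

/-! ### Hermite's theorem for Galois extensions of prime degree -/

section Hermite

open NumberField IsDedekindDomain Module

variable {K L : Type*} [Field K] [Field L] [NumberField K] [NumberField L] [Algebra K L]

instance (w : HeightOneSpectrum (𝓞 L)) : w.asIdeal.LiesOver (w.under (𝓞 K)).asIdeal := ⟨rfl⟩

/-- In a totally ramified extension of prime degree `p`, the exponent of the different at the
ramified prime `w` is at most `w p + p - 1`. Indeed the different divides `f' α`, where `f` is the
minimal polynomial of a uniformizer `α`, and the terms of `f' α` have distinct valuations, because
the valuations of elements of `K` are divisible by `p`. -/
lemma pow_dvd_of_pow_dvd_differentIdeal {p : ℕ} (hp : p.Prime) (hL : finrank K L = p)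
    (w : HeightOneSpectrum (𝓞 L))
    (hw : (w.under (𝓞 K)).asIdeal.ramificationIdx' w.asIdeal = p) {k : ℕ}
    (hk : w.asIdeal ^ k ∣ differentIdeal (𝓞 K) (𝓞 L)) :
    w.asIdeal ^ k ∣ Ideal.span {(p : 𝓞 L)} * w.asIdeal ^ (p - 1) := by
  set v := w.under (𝓞 K)
  obtain ⟨α, hα⟩ := w.intValuation_exists_uniformizer
  have hval : ∀ c : 𝓞 K, w.intValuation (algebraMap (𝓞 K) (𝓞 L) c) = v.intValuation c ^ p := by
    intro c
    rw [← HeightOneSpectrum.intValuation_liesOver v w, hw]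
  have hαint : IsIntegral (𝓞 K) α := Algebra.IsIntegral.isIntegral α
  set f := minpoly (𝓞 K) α
  -- The valuation of `α` is not divisible by `p`, so `α ∉ K`, and `[L : K]` is prime.
  have hgen : IntermediateField.adjoin K {(algebraMap (𝓞 L) L α)} = ⊤ := by
    have := IntermediateField.isSimpleOrder_of_finrank_prime K L (hL ▸ hp)
    refine (eq_bot_or_eq_top _).resolve_left fun h => ?_
    rw [IntermediateField.adjoin_simple_eq_bot_iff, IntermediateField.mem_bot] at h
    obtain ⟨c, hc⟩ := h
    have h1 := HeightOneSpectrum.valuation_liesOver L v w c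
    rw [hc, hw, HeightOneSpectrum.valuation_of_algebraMap, hα] at h1
    have hc0 : v.valuation K c ≠ 0 := by
      intro h0
      rw [h0, zero_pow hp.ne_zero] at h1
      exact WithZero.exp_ne_zero h1.symm
    rw [← WithZero.exp_log hc0, ← WithZero.exp_nsmul, WithZero.exp_inj] at h1
    have h2 : (p : ℤ) ∣ 1 := ⟨-WithZero.log (v.valuation K c), by
      rw [nsmul_eq_mul] at h1; linarith⟩
    exact hp.one_lt.ne' (by exact_mod_cast Int.eq_one_of_dvd_one (by positivity) h2)
  have hdeg : f.natDegree = p := by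
    have h1 : (minpoly K (algebraMap (𝓞 L) L α)).natDegree = p := by
      rw [← IntermediateField.adjoin.finrank (Algebra.IsIntegral.isIntegral _), hgen,
        IntermediateField.finrank_top', hL]
    rwa [minpoly.isIntegrallyClosed_eq_field_fractions K L hαint,
      (minpoly.monic hαint).natDegree_map] at h1
  have hdiff : Polynomial.aeval α f.derivative ∈ differentIdeal (𝓞 K) (𝓞 L) := by
    refine aeval_derivative_mem_differentIdeal (𝓞 K) K L α ?_
    rw [← IntermediateField.adjoin_simple_toSubalgebra_of_isAlgebraic
      (Algebra.IsAlgebraic.isAlgebraic _), hgen, IntermediateField.top_toSubalgebra]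
  have hle : w.intValuation (Polynomial.aeval α f.derivative) ≤ WithZero.exp (-(k : ℤ)) :=
    (w.intValuation_le_pow_iff_mem _ k).mpr (Ideal.le_of_dvd hk hdiff)
  have hsum : Polynomial.aeval α f.derivative =
      ∑ j ∈ Finset.range p, algebraMap (𝓞 K) (𝓞 L) (f.derivative.coeff j) * α ^ j := by
    rw [Polynomial.aeval_eq_sum_range' (n := p)]
    · simp only [Algebra.smul_def]
    · have := Polynomial.natDegree_derivative_lt (p := f) (by rw [hdeg]; exact hp.ne_zero)
      rwa [hdeg] at this
  set g : ℕ → 𝓞 L := fun j => algebraMap (𝓞 K) (𝓞 L) (f.derivative.coeff j) * α ^ j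
  have hg : ∀ j, w.intValuation (g j) =
      v.intValuation (f.derivative.coeff j) ^ p * WithZero.exp (-(j : ℤ)) := by
    intro j
    rw [map_mul, map_pow, hα, hval, ← WithZero.exp_nsmul]
    simp
  have hlast : g (p - 1) = p * α ^ (p - 1) := by
    have h1 : p - 1 + 1 = p := Nat.sub_add_cancel hp.one_le
    have h2 : f.coeff p = 1 := by
      rw [← hdeg]; exact (minpoly.monic hαint).coeff_natDegree
    simp only [g, Polynomial.coeff_derivative, h1, h2]
    rw [← Nat.cast_succ, Nat.succ_eq_add_one, h1]
    simp
  have hp0 : (p : 𝓞 L) ≠ 0 := Nat.cast_ne_zero.mpr hp.ne_zero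
  have hα0 : α ≠ 0 := by
    rintro rfl
    rw [map_zero] at hα
    exact WithZero.exp_ne_zero hα.symm
  have hlast0 : w.intValuation (g (p - 1)) ≠ 0 :=
    w.intValuation_ne_zero _ (by rw [hlast]; exact mul_ne_zero hp0 (pow_ne_zero _ hα0))
  have hmem : p - 1 ∈ Finset.range p := Finset.mem_range.mpr (Nat.sub_lt hp.pos one_pos)
  -- Two terms of equal nonzero valuation have exponents congruent modulo `p`.
  have hinj : ∀ i ∈ Finset.range p, ∀ j ∈ Finset.range p, w.intValuation (g j) ≠ 0 →
      w.intValuation (g i) = w.intValuation (g j) → i = j := by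
    intro i hi j hj hj0 hij
    have hi0 := hij ▸ hj0
    rw [hg] at hi0 hj0
    have hi0' := (pow_ne_zero_iff hp.ne_zero).mp (left_ne_zero_of_mul hi0)
    have hj0' := (pow_ne_zero_iff hp.ne_zero).mp (left_ne_zero_of_mul hj0)
    rw [hg, hg, ← WithZero.exp_log hi0', ← WithZero.exp_log hj0', ← WithZero.exp_nsmul,
      ← WithZero.exp_nsmul, ← WithZero.exp_add, ← WithZero.exp_add, WithZero.exp_inj,
      nsmul_eq_mul, nsmul_eq_mul] at hij
    have h1 : (p : ℤ) ∣ (i : ℤ) - j :=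
      ⟨WithZero.log (v.intValuation (f.derivative.coeff i)) -
        WithZero.log (v.intValuation (f.derivative.coeff j)), by linarith⟩
    have h2 := Int.eq_zero_of_abs_lt_dvd h1 (by
      have := Finset.mem_range.mp hi
      have := Finset.mem_range.mp hj
      rw [abs_lt]; constructor <;> omega)
    omega
  obtain ⟨j₀, hj₀, hmax⟩ := Finset.exists_max_image (Finset.range p)
    (fun j => w.intValuation (g j)) ⟨p - 1, hmem⟩
  have hj₀0 : w.intValuation (g j₀) ≠ 0 := fun h =>
    hlast0 (le_zero_iff.mp (h ▸ hmax _ hmem))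
  -- Hence the valuation of the sum is that of its largest term, at least that of the last term.
  have hval_sum : w.intValuation (Polynomial.aeval α f.derivative) = w.intValuation (g j₀) := by
    rw [hsum]
    refine Valuation.map_sum_eq_of_lt _ hj₀ fun i hi => ?_
    rw [Finset.mem_sdiff, Finset.mem_singleton] at hi
    exact lt_of_le_of_ne (hmax i hi.1) fun h => hi.2 (hinj i hi.1 j₀ hj₀ hj₀0 h)
  have hfin : w.intValuation (p * α ^ (p - 1)) ≤ WithZero.exp (-(k : ℤ)) := by
    rw [← hlast]
    exact (hmax _ hmem).trans (hval_sum ▸ hle)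
  rw [map_mul, map_pow, hα, w.intValuation_eq_exp_neg_multiplicity hp0, ← WithZero.exp_nsmul,
    ← WithZero.exp_add, WithZero.exp_le_exp, nsmul_eq_mul] at hfin
  have hkle : k ≤ multiplicity w.asIdeal (Ideal.span {(p : 𝓞 L)}) + (p - 1) := by
    zify
    linarith
  calc w.asIdeal ^ k ∣ w.asIdeal ^ (multiplicity w.asIdeal (Ideal.span {(p : 𝓞 L)}) + (p - 1)) :=
        pow_dvd_pow _ hkle
    _ ∣ _ := by
      rw [pow_add]
      exact mul_dvd_mul_right (pow_multiplicity_dvd _ _) _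

section Ramification

attribute [local instance] FractionRing.liftAlgebra

/-- In a Galois extension of prime degree a prime that divides the different is totally ramified
and has nontrivial inertia. -/
lemma ramified_of_dvd_differentIdeal [IsGalois K L] {p : ℕ} (hp : p.Prime) (hL : finrank K L = p)
    (w : HeightOneSpectrum (𝓞 L)) (hw : w.asIdeal ∣ differentIdeal (𝓞 K) (𝓞 L)) :
    (w.under (𝓞 K)).asIdeal.ramificationIdx' w.asIdeal = p ∧
      Nat.card (w.asIdeal.inertia Gal(L/K)) = p := by
  have h1 : ¬ Algebra.IsUnramifiedAt (𝓞 K) w.asIdeal := dvd_differentIdeal_iff.mp hw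
  rw [← Ideal.ramificationIdx_eq_one_iff] at h1
  have h2 := Ideal.card_inertia_eq_ramificationIdxIn (G := Gal(L/K)) (w.under (𝓞 K)).asIdeal
    w.asIdeal
  rw [Ideal.ramificationIdxIn_eq_ramificationIdx (w.under (𝓞 K)).asIdeal w.asIdeal Gal(L/K)] at h2
  have h3 : Nat.card (w.asIdeal.inertia Gal(L/K)) ∣ p := by
    rw [← hL, ← IsGalois.card_aut_eq_finrank]
    exact Subgroup.card_subgroup_dvd_card _
  have h4 := ((Nat.dvd_prime hp).mp h3).resolve_left (h2 ▸ h1)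
  refine ⟨?_, h4⟩
  have hmap : (w.under (𝓞 K)).asIdeal.map (algebraMap (𝓞 K) (𝓞 L)) ≠ ⊥ :=
    (Ideal.map_eq_bot_iff_of_injective (FaithfulSMul.algebraMap_injective _ _)).not.mpr
      (w.under (𝓞 K)).ne_bot
  rw [← h4, h2, Ideal.IsDedekindDomain.ramificationIdx_eq_normalizedFactors_count _ _ hmap,
    Ideal.IsDedekindDomain.ramificationIdx'_eq_normalizedFactors_count hmap w.isPrime w.ne_bot]

end Ramification

/-- The different of a Galois extension of prime degree `p` with trivial inertia outside `S` is
bounded in terms of `p` and `S` alone. -/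
lemma differentIdeal_dvd_map [IsGalois K L] {p : ℕ} (hp : p.Prime) (hL : finrank K L = p)
    (S : Finset (HeightOneSpectrum (𝓞 K)))
    (hS : ∀ w : HeightOneSpectrum (𝓞 L), w.under (𝓞 K) ∉ S →
      ∀ σ ∈ w.asIdeal.inertia Gal(L/K), σ = 1) :
    differentIdeal (𝓞 K) (𝓞 L) ∣ Ideal.map (algebraMap (𝓞 K) (𝓞 L))
      (Ideal.span {(p : 𝓞 K)} * (∏ v ∈ S, v.asIdeal) ^ (p - 1)) := by
  rw [UniqueFactorizationMonoid.dvd_iff_emultiplicity_le differentIdeal_ne_bot]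
  intro P hP
  let w : HeightOneSpectrum (𝓞 L) := ⟨P, Ideal.isPrime_of_prime hP, hP.ne_zero⟩
  refine emultiplicity_le_emultiplicity_iff.mpr fun k hk => ?_
  rcases Nat.eq_zero_or_pos k with rfl | hk0
  · simp
  obtain ⟨h1, h2⟩ := ramified_of_dvd_differentIdeal (K := K) hp hL w
    ((dvd_pow_self P hk0.ne').trans hk)
  have hwS : w.under (𝓞 K) ∈ S := by
    by_contra h
    have h3 : w.asIdeal.inertia Gal(L/K) = ⊥ := (Subgroup.eq_bot_iff_forall _).mpr (hS w h)
    rw [h3, Subgroup.card_bot] at h2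
    exact hp.one_lt.ne h2
  refine (pow_dvd_of_pow_dvd_differentIdeal hp hL w h1 hk).trans ?_
  rw [Ideal.map_mul, Ideal.map_span, Set.image_singleton, map_natCast, Ideal.map_pow]
  refine mul_dvd_mul_left _ (pow_dvd_pow_of_dvd ?_ _)
  rw [Ideal.dvd_iff_le, Ideal.map_le_iff_le_comap]
  have hle : ∏ v ∈ S, v.asIdeal ≤ (w.under (𝓞 K)).asIdeal :=
    Ideal.le_of_dvd (Finset.dvd_prod_of_mem (fun v : HeightOneSpectrum (𝓞 K) => v.asIdeal) hwS)
  exact hle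

/-- Hermite's theorem for Galois extensions of prime degree: there are only finitely many with
trivial inertia outside a given finite set of primes. -/
theorem finite_isGalois_of_inertia_trivial {Ω : Type*} [Field Ω] [Algebra K Ω] {p : ℕ}
    (hp : p.Prime) (S : Finset (HeightOneSpectrum (𝓞 K))) :
    {M : IntermediateField K Ω | IsGalois K M ∧ finrank K M = p ∧
      ∀ w : HeightOneSpectrum (𝓞 M), w.under (𝓞 K) ∉ S →
        ∀ σ ∈ w.asIdeal.inertia Gal(M/K), σ = 1}.Finite := by
  have : CharZero Ω := charZero_of_injective_algebraMap (algebraMap K Ω).injective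
  set I : Ideal (𝓞 K) := Ideal.span {(p : 𝓞 K)} * (∏ v ∈ S, v.asIdeal) ^ (p - 1)
  have hI : I ≠ 0 := by
    refine mul_ne_zero ?_ (pow_ne_zero _ (Finset.prod_ne_zero_iff.mpr fun v _ => v.ne_bot))
    rw [Ne, Submodule.zero_eq_bot, Ideal.span_singleton_eq_bot]
    exact Nat.cast_ne_zero.mpr hp.ne_zero
  set N : ℕ := I.absNorm ^ p * (discr K).natAbs ^ p
  refine Set.Finite.of_injOn (f := fun M => M.restrictScalars ℚ)
    (t := Subtype.val '' {M : {M : IntermediateField ℚ Ω // FiniteDimensional ℚ M} |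
      haveI : NumberField M := @NumberField.mk _ _ inferInstance M.prop
      |discr M| ≤ N}) ?_ (IntermediateField.restrictScalars_injective ℚ).injOn
    ((finite_of_discr_bdd Ω N).image _)
  rintro M ⟨hM, hMp, hMS⟩
  have : FiniteDimensional K M := FiniteDimensional.of_finrank_pos (hMp ▸ hp.pos)
  have hfin : FiniteDimensional ℚ M := FiniteDimensional.trans ℚ K M
  have : NumberField M := @NumberField.mk _ _ inferInstance hfin
  refine ⟨⟨M.restrictScalars ℚ, hfin⟩, ?_, rfl⟩
  change |discr M| ≤ N
  rw [Int.abs_eq_natAbs,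
    natAbs_discr_eq_absNorm_differentIdeal_mul_natAbs_discr_pow K (𝓞 K) M (𝓞 M), hMp]
  have hrank : finrank (𝓞 K) (𝓞 M) = p := by
    rw [← IsFractionRing.finrank_eq (𝓞 K) K (𝓞 M) M, hMp]
  have h1 := Ideal.absNorm_dvd_absNorm_of_le
    (Ideal.le_of_dvd (differentIdeal_dvd_map hp hMp S hMS))
  rw [Ideal.absNorm_algebraMap, hrank] at h1
  have h2 : I.absNorm ^ p ≠ 0 := pow_ne_zero _ (Ideal.absNorm_eq_zero_iff.not.mpr hI)
  exact_mod_cast Nat.mul_le_mul_right _ (Nat.le_of_dvd (Nat.pos_of_ne_zero h2) h1)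

end Hermite

/-! ### Inertia groups and torsion translations -/

section Inertia

open NumberField IsDedekindDomain Module

/-- An element of the inertia group at `w` acts trivially on the residue field of the valuation
ring of `w`. -/
lemma valuation_sub_lt_one_of_mem_inertia {K L : Type*} [Field K] [Field L] [NumberField L]
    [Algebra K L] (w : HeightOneSpectrum (𝓞 L)) {σ : Gal(L/K)}
    (hσ : σ ∈ w.asIdeal.inertia Gal(L/K)) {x : L} (hx : x ∈ (w.valuation L).valuationSubring) :
    (w.valuation L).valuationSubring.valuation (σ x - x) < 1 := by
  have hσ' : ∀ y : 𝓞 L, σ • y - y ∈ w.asIdeal := hσ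
  rw [← (Valuation.isEquiv_valuation_valuationSubring (w.valuation L)).lt_one_iff_lt_one]
  obtain ⟨a, ⟨d, hd⟩, hxd⟩ := w.exists_primeCompl_mul_eq_of_integer x hx
  have hd' : d ∉ w.asIdeal := hd
  have hσd : σ • d ∉ w.asIdeal := fun h => hd' (by
    have := w.asIdeal.sub_mem h (hσ' d)
    rwa [sub_sub_cancel] at this)
  have hact : ∀ y : 𝓞 L, algebraMap (𝓞 L) L (σ • y) = σ (algebraMap (𝓞 L) L y) := fun _ => rfl
  have hmem : σ • a * d - a * σ • d ∈ w.asIdeal := by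
    have : σ • a * d - a * σ • d = (σ • a - a) * d - a * (σ • d - d) := by ring
    rw [this]
    exact w.asIdeal.sub_mem (w.asIdeal.mul_mem_right _ (hσ' a)) (w.asIdeal.mul_mem_left _ (hσ' d))
  have hmul : (σ x - x) * algebraMap (𝓞 L) L (d * σ • d) =
      algebraMap (𝓞 L) L (σ • a * d - a * σ • d) := by
    have hσx := congrArg σ hxd
    rw [map_mul] at hσx
    simp only [map_sub, map_mul, hact]
    rw [← hσx, ← hxd]
    ring
  have hunit : w.valuation L (algebraMap (𝓞 L) L (d * σ • d)) = 1 :=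
    w.valuation_eq_one_iff_notMem.mpr fun h => (w.isPrime.mem_or_mem h).elim hd' hσd
  have hlt : w.valuation L (algebraMap (𝓞 L) L (σ • a * d - a * σ • d)) < 1 :=
    (w.valuation_lt_one_iff_mem _).mpr hmem
  rwa [← hmul, map_mul, hunit, mul_one] at hlt

variable {K : Type u} [Field K] [NumberField K] {Ω : Type u} [Field Ω] [Algebra K Ω]

/-- An element of `K` is integral outside a finite set of primes, at all primes of all extensions
above the remaining ones. -/
lemma finite_setOf_valuation_algebraMap (c : K) :
    {v : HeightOneSpectrum (𝓞 K) | ∃ (M : IntermediateField K Ω) (_ : NumberField M)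
      (w : HeightOneSpectrum (𝓞 M)), w.under (𝓞 K) = v ∧
        algebraMap K M c ∉ (w.valuation M).valuationSubring}.Finite := by
  obtain ⟨a, b, hb, rfl⟩ := IsFractionRing.div_surjective (A := 𝓞 K) c
  have hb0 : b ≠ 0 := nonZeroDivisors.ne_zero hb
  refine (Ideal.finite_factors (I := Ideal.span {b})
    (by rwa [Ne, Submodule.zero_eq_bot, Ideal.span_singleton_eq_bot])).subset ?_
  rintro _ ⟨M, _, w, rfl, hw⟩
  rw [Set.mem_ofPred_eq, Ideal.dvd_span_singleton]
  by_contra hmem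
  refine hw ?_
  have h1 : algebraMap (𝓞 K) (𝓞 M) b ∉ w.asIdeal := hmem
  have h2 : ∀ y : 𝓞 K, algebraMap K M (algebraMap (𝓞 K) K y) =
    algebraMap (𝓞 M) M (algebraMap (𝓞 K) (𝓞 M) y) := fun _ => rfl
  rw [Valuation.mem_valuationSubring_iff, map_div₀, map_div₀, h2, h2,
    w.valuation_eq_one_iff_notMem.mpr h1, div_one]
  exact w.valuation_le_one _

/-- Let `E` be proper over a number field `K`, and `n ≠ 0`. Outside a finite set of primes of `K`,
no element `σ` of an inertia group of a finite extension `M / K` moves a point `P ∈ E(M)` by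
an `n`-torsion point. -/
theorem finite_setOf_inertia_moves (E : Over (Spec (.of K))) [GrpObj E] [IsProper E.hom] {n : ℕ}
    (hn : n ≠ 0) :
    {v : HeightOneSpectrum (𝓞 K) | ∃ (M : IntermediateField K Ω) (_ : NumberField M)
      (w : HeightOneSpectrum (𝓞 M)) (σ : Gal(M/K)) (P : RingPoints E M), w.under (𝓞 K) = v ∧
        σ ∈ w.asIdeal.inertia Gal(M/K) ∧ n • (-P + pointMap (σ : M →ₐ[K] M) P) = 0 ∧
          pointMap (σ : M →ₐ[K] M) P ≠ P}.Finite := by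
  by_contra hinf
  rw [Set.not_finite] at hinf
  set J := {v : HeightOneSpectrum (𝓞 K) | ∃ (M : IntermediateField K Ω) (_ : NumberField M)
      (w : HeightOneSpectrum (𝓞 M)) (σ : Gal(M/K)) (P : RingPoints E M), w.under (𝓞 K) = v ∧
        σ ∈ w.asIdeal.inertia Gal(M/K) ∧ n • (-P + pointMap (σ : M →ₐ[K] M) P) = 0 ∧
          pointMap (σ : M →ₐ[K] M) P ≠ P}
  have : Infinite J := hinf.to_subtype
  choose M hM w σ P hw hσ hP hne using fun v : J => v.2
  obtain ⟨i, hi⟩ := exists_pointMap_eq (E := E) (J := J) (fun i => M i)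
    (fun i => ((w i).valuation (M i)).valuationSubring) (fun i => (σ i : M i →ₐ[K] M i))
    (fun c => by
      refine ((finite_setOf_valuation_algebraMap (Ω := Ω) c).preimage
        Subtype.val_injective.injOn).subset fun i hi => ?_
      exact ⟨M i, hM i, w i, hw i, hi⟩)
    (fun i x hx => valuation_sub_lt_one_of_mem_inertia (w i) (hσ i) hx)
    (Nat.cast_ne_zero.mpr hn) P hP
  exact hne i hi

end Inertia

/-! ### The field generated by the coordinates of a point -/

section

variable {K : Type u} [Field K]

section CoordField

variable {E : Over (Spec (.of K))} {L L' : Type u} [Field L] [Field L'] [Algebra K L]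
  [Algebra K L']

/-- The field generated by the coordinates can be computed from any factorization of the point
through the spectrum of a residue field. -/
lemma coordField_eq_adjoin (P : RingPoints E L) {x : E.left}
    (ψ : E.left.residueField x ⟶ .of L)
    (h : P.toMul.left = Spec.map ψ ≫ E.left.fromSpecResidueField x) :
    coordField P = IntermediateField.adjoin K (Set.range ψ.hom) := by
  have h' : Scheme.SpecToEquivOfField L E.left P.toMul.left = ⟨x, ψ⟩ := by
    rw [h]
    exact (Scheme.SpecToEquivOfField L E.left).apply_symm_apply ⟨x, ψ⟩
  rw [coordField, h']

lemma exists_eq_map_comp_fromSpecResidueField (P : RingPoints E L) :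
    ∃ (x : E.left) (ψ : E.left.residueField x ⟶ .of L),
      P.toMul.left = Spec.map ψ ≫ E.left.fromSpecResidueField x :=
  ⟨_, _, ((Scheme.SpecToEquivOfField L E.left).symm_apply_apply P.toMul.left).symm⟩

lemma coordField_baseChange (f : L →ₐ[K] L') (P : RingPoints E L) :
    coordField (baseChange f P) = (coordField P).map f := by
  obtain ⟨x, ψ, h⟩ := exists_eq_map_comp_fromSpecResidueField P
  have h' : (baseChange f P).toMul.left =
      Spec.map (ψ ≫ CommRingCat.ofHom f.toRingHom) ≫ E.left.fromSpecResidueField x := by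
    rw [Spec.map_comp, Category.assoc, ← h]
    rfl
  rw [coordField_eq_adjoin _ _ h', coordField_eq_adjoin _ _ h, IntermediateField.adjoin_map]
  congr 1
  rw [← Set.range_comp]
  rfl

/-- A point comes from a subfield exactly if its coordinates lie there. -/
lemma exists_baseChange_eq_iff (P : RingPoints E L) (F : IntermediateField K L) :
    (∃ P₀ : RingPoints E F, baseChange F.val P₀ = P) ↔ coordField P ≤ F := by
  constructor
  · rintro ⟨P₀, rfl⟩
    rw [coordField_baseChange]
    rintro _ ⟨y, -, rfl⟩
    exact y.2
  · intro hF
    obtain ⟨x, ψ, h⟩ := exists_eq_map_comp_fromSpecResidueField P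
    rw [coordField_eq_adjoin P ψ h, IntermediateField.adjoin_le_iff] at hF
    let ψ₀ : E.left.residueField x ⟶ .of F :=
      CommRingCat.ofHom (ψ.hom.codRestrict F fun y => hF ⟨y, rfl⟩)
    have hψ : Spec.map (CommRingCat.ofHom F.val.toRingHom) ≫ Spec.map ψ₀ = Spec.map ψ := by
      rw [← Spec.map_comp]
      rfl
    have hw : (Spec.map ψ₀ ≫ E.left.fromSpecResidueField x) ≫ E.hom =
        (affineOver K F).hom := by
      obtain ⟨φ, hφ⟩ := Spec.map_surjective
        ((Spec.map ψ₀ ≫ E.left.fromSpecResidueField x) ≫ E.hom)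
      have h1 := Over.w P.toMul
      rw [h, ← hψ] at h1
      have h2 : Spec.map (CommRingCat.ofHom F.val.toRingHom) ≫ Spec.map φ =
          Spec.map (CommRingCat.ofHom (algebraMap K L)) := by
        rw [hφ]
        simp only [Category.assoc] at h1 ⊢
        exact h1
      rw [← Spec.map_comp, Spec.map_inj] at h2
      rw [← hφ]
      refine congrArg Spec.map ?_
      ext c
      exact ConcreteCategory.congr_hom h2 c
    refine ⟨Additive.ofMul (Over.homMk (Spec.map ψ₀ ≫ E.left.fromSpecResidueField x) hw), ?_⟩
    refine congrArg Additive.ofMul (Over.OverMorphism.ext ?_)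
    change Spec.map (CommRingCat.ofHom F.val.toRingHom) ≫
      Spec.map ψ₀ ≫ E.left.fromSpecResidueField x = P.toMul.left
    rw [h, ← hψ, Category.assoc]

lemma isNew_iff (P : RingPoints E L) : IsNew P ↔ coordField P = ⊤ := by
  constructor
  · intro h
    by_contra hne
    obtain ⟨P₀, hP₀⟩ := (exists_baseChange_eq_iff P _).mpr le_rfl
    exact h _ hne P₀ hP₀
  · intro h F hF P₀ hP₀
    exact hF (top_le_iff.mp (h ▸ (exists_baseChange_eq_iff P F).mp ⟨P₀, hP₀⟩))

lemma baseChange_eq_self_iff (σ : L →ₐ[K] L) (P : RingPoints E L) :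
    baseChange σ P = P ↔ ∀ x ∈ coordField P, σ x = x := by
  constructor
  · intro h
    obtain ⟨x, ψ, hψ⟩ := exists_eq_map_comp_fromSpecResidueField P
    have h1 : Spec.map (ψ ≫ CommRingCat.ofHom σ.toRingHom) ≫ E.left.fromSpecResidueField x =
        Spec.map ψ ≫ E.left.fromSpecResidueField x := by
      rw [Spec.map_comp, Category.assoc, ← hψ]
      exact congrArg (fun m : RingPoints E L => m.toMul.left) h
    rw [cancel_mono, Spec.map_inj] at h1
    rw [coordField_eq_adjoin P ψ hψ]
    intro y hy
    have hle : IntermediateField.adjoin K (Set.range ψ.hom) ≤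
        (AlgHom.equalizer σ (AlgHom.id K L)).toIntermediateField (fun z hz => by
          rw [AlgHom.mem_equalizer] at hz ⊢
          rw [map_inv₀, hz, map_inv₀]) := by
      rw [IntermediateField.adjoin_le_iff]
      rintro _ ⟨z, rfl⟩
      exact ConcreteCategory.congr_hom h1 z
    exact hle hy
  · intro h
    obtain ⟨P₀, hP₀⟩ := (exists_baseChange_eq_iff P _).mpr le_rfl
    rw [← hP₀]
    refine congrArg Additive.ofMul (?_ :
      affineMap σ ≫ affineMap (coordField P).val ≫ P₀.toMul = affineMap _ ≫ P₀.toMul)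
    rw [← Category.assoc, ← affineMap_comp]
    congr 2
    ext y
    exact h y y.2

variable [GrpObj E]

lemma coordField_add_le (P Q : RingPoints E L) :
    coordField (P + Q) ≤ coordField P ⊔ coordField Q := by
  obtain ⟨P₀, hP₀⟩ := (exists_baseChange_eq_iff P _).mpr (le_sup_left (b := coordField Q))
  obtain ⟨Q₀, hQ₀⟩ := (exists_baseChange_eq_iff Q _).mpr (le_sup_right (a := coordField P))
  refine (exists_baseChange_eq_iff _ _).mp ⟨P₀ + Q₀, ?_⟩
  exact (map_add (pointMap _) P₀ Q₀).trans (congrArg₂ (· + ·) hP₀ hQ₀)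

lemma coordField_neg_le (P : RingPoints E L) : coordField (-P) ≤ coordField P := by
  obtain ⟨P₀, hP₀⟩ := (exists_baseChange_eq_iff P _).mpr le_rfl
  exact (exists_baseChange_eq_iff _ _).mp
    ⟨-P₀, (map_neg (pointMap _) P₀).trans (congrArg Neg.neg hP₀)⟩

lemma coordField_le_of_add (P Q : RingPoints E L) :
    coordField Q ≤ coordField P ⊔ coordField (P + Q) := by
  have h := coordField_add_le (-P) (P + Q)
  rw [neg_add_cancel_left] at h
  exact h.trans (sup_le_sup_right (coordField_neg_le P) _)

lemma coordField_le_of_add' (P Q : RingPoints E L) :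
    coordField P ≤ coordField Q ⊔ coordField (P + Q) := by
  have h := coordField_add_le (P + Q) (-Q)
  rw [add_neg_cancel_right, sup_comm] at h
  exact h.trans (sup_le_sup_right (coordField_neg_le Q) _)

/-- A point whose coordinates lie in `K` comes from `E(K)`. -/
lemma exists_pointMap_ofId_eq (P : RingPoints E L) (h : coordField P ≤ ⊥) :
    ∃ P₀ : RingPoints E K, pointMap (Algebra.ofId K L) P₀ = P := by
  obtain ⟨P₀, hP₀⟩ := (exists_baseChange_eq_iff P _).mpr h
  refine ⟨pointMap (IntermediateField.botEquiv K L : _ →ₐ[K] K) P₀, ?_⟩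
  rw [← pointMap_comp, ← hP₀]
  change _ = pointMap _ P₀
  congr 2
  ext y
  obtain ⟨c, hc⟩ := IntermediateField.mem_bot.mp y.2
  have hy : y = algebraMap K _ c := Subtype.ext hc.symm
  rw [hy]
  simp

end CoordField

end

/-! ### Sums of new points over a compositum -/

section

variable {K : Type u} [Field K]

section Compositum

open Module

variable {E : Over (Spec (.of K))} {Ω : Type u} [Field Ω] [Algebra K Ω]

lemma coordField_baseChange_val {L : IntermediateField K Ω} (P : RingPoints E L) :
    coordField (baseChange L.val P) = IntermediateField.lift (coordField P) :=
  coordField_baseChange L.val P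

lemma isNew_iff_coordField_baseChange_val {L : IntermediateField K Ω} (P : RingPoints E L) :
    IsNew P ↔ coordField (baseChange L.val P) = L := by
  rw [isNew_iff, coordField_baseChange_val, ← IntermediateField.lift_inj,
    IntermediateField.lift_top]

lemma coordField_baseChange_algEquiv [Normal K Ω] (τ : Gal(Ω/K)) (X : RingPoints E Ω)
    [Normal K (coordField X)] :
    coordField (baseChange (τ : Ω →ₐ[K] Ω) X) = coordField X := by
  rw [coordField_baseChange]
  exact IntermediateField.normal_iff_forall_map_eq'.mp inferInstance τ

variable [GrpObj E]

lemma baseChange_val_addCompositum {L₁ L₂ : IntermediateField K Ω} (P : RingPoints E L₁)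
    (Q : RingPoints E L₂) :
    baseChange (L₁ ⊔ L₂).val (addCompositum P Q) =
      (baseChange L₁.val P + baseChange L₂.val Q : RingPoints E Ω) := by
  refine (map_add (pointMap (L₁ ⊔ L₂).val) _ _).trans (congrArg₂ (· + ·) ?_ ?_)
  · exact (pointMap_comp (L₁ ⊔ L₂).val (IntermediateField.inclusion le_sup_left) P).symm
  · exact (pointMap_comp (L₁ ⊔ L₂).val (IntermediateField.inclusion le_sup_right) Q).symm

/-- If `A` and `B` are linearly disjoint and `B ≤ A ⊔ M`, then `[B : K] ≤ [M : K]`: the left side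
is `[A ⊔ B : A]`, and `A ⊔ B ≤ A ⊔ M` is generated over `A` by a `K`-basis of `M`. -/
lemma rank_le_of_le_sup [Algebra.IsAlgebraic K Ω] {A B M : IntermediateField K Ω}
    (h : A.LinearDisjoint B) (hB : B ≤ A ⊔ M) : Module.rank K B ≤ Module.rank K M := by
  have h1 : Module.rank A (IntermediateField.adjoin A (B : Set Ω)) = Module.rank K B :=
    IntermediateField.LinearDisjoint.adjoin_rank_eq_rank_left_of_isAlgebraic_left h.symm
  have h2 : IntermediateField.adjoin A (B : Set Ω) ≤ IntermediateField.adjoin A (M : Set Ω) := by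
    rw [IntermediateField.adjoin_le_iff]
    intro x hx
    have hle : A ⊔ M ≤ (IntermediateField.adjoin A (M : Set Ω)).restrictScalars K := by
      refine sup_le (fun a ha => ?_) (fun m hm => IntermediateField.subset_adjoin A _ hm)
      exact (IntermediateField.adjoin A (M : Set Ω)).algebraMap_mem ⟨a, ha⟩
    exact hle (hB hx)
  rw [← h1]
  exact (LinearMap.rank_le_of_injective (IntermediateField.inclusion h2).toLinearMap
    (IntermediateField.inclusion_injective h2)).trans
      (IntermediateField.adjoin_rank_le_of_isAlgebraic_left A M)

/-- If `τ X = X + T` and `T` is fixed by `τ`, then `T` is killed by the exponent of the Galois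
group of the coordinate field of `X`. -/
lemma exponent_nsmul_eq_zero {L : IntermediateField K Ω} [Normal K L] (τ : Gal(Ω/K))
    (X T : RingPoints E Ω) (hX : coordField X ≤ L) (hT : pointMap (τ : Ω →ₐ[K] Ω) T = T)
    (h : pointMap (τ : Ω →ₐ[K] Ω) X = X + T) : Monoid.exponent Gal(L/K) • T = 0 := by
  have hpow : ∀ n : ℕ, pointMap ((τ ^ n : Gal(Ω/K)) : Ω →ₐ[K] Ω) X = X + n • T := by
    intro n
    induction n with
    | zero =>
      rw [pow_zero, zero_nsmul, add_zero]
      exact pointMap_id X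
    | succ n ih =>
      have : ((τ ^ (n + 1) : Gal(Ω/K)) : Ω →ₐ[K] Ω) =
          (τ : Ω →ₐ[K] Ω).comp ((τ ^ n : Gal(Ω/K)) : Ω →ₐ[K] Ω) := by
        rw [pow_succ']
        rfl
      rw [this, pointMap_comp, ih, map_add, map_nsmul, hT, h, add_assoc, succ_nsmul']
  have hfix : pointMap ((τ ^ Monoid.exponent Gal(L/K) : Gal(Ω/K)) : Ω →ₐ[K] Ω) X = X := by
    refine (baseChange_eq_self_iff _ X).mpr fun x hx => ?_
    have h1 := AlgEquiv.restrictNormalHom_apply L (τ ^ Monoid.exponent Gal(L/K)) ⟨x, hX hx⟩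
    rw [map_pow, Monoid.pow_exponent_eq_one] at h1
    exact h1.symm
  have h1 := hpow (Monoid.exponent Gal(L/K))
  rw [hfix] at h1
  exact (left_eq_add.mp h1)

/-- Let `X` and `Y` be points whose coordinate fields `L₁` and `L₂` are Galois over `K` and meet
in `K`. If the coordinates of `X + Y` do not generate `L₁ L₂`, some automorphism `τ` moves `X` by
a nonzero point `T` of `E(K)`. Indeed `τ` is chosen to fix `X + Y` but not `L₁ L₂`; then
`τ X - X = Y - τ Y` is defined over `L₁` and over `L₂`. -/
lemma exists_translation_of_coordField_add_ne [Normal K Ω] {X Y : RingPoints E Ω}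
    {L₁ L₂ : IntermediateField K Ω} [IsGalois K L₁] [IsGalois K L₂] (hL₁ : coordField X = L₁)
    (hL₂ : coordField Y = L₂) (hinf : L₁ ⊓ L₂ = ⊥) (hne : coordField (X + Y) ≠ L₁ ⊔ L₂) :
    ∃ (τ : Gal(Ω/K)) (T : RingPoints E Ω), pointMap (τ : Ω →ₐ[K] Ω) X = X + T ∧ T ≠ 0 ∧
      coordField T ≤ ⊥ ∧ Monoid.exponent Gal(L₁/K) • T = 0 ∧
        Monoid.exponent Gal(L₂/K) • T = 0 := by
  subst hL₁ hL₂
  set L := coordField X ⊔ coordField Y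
  have hle : coordField (X + Y) ≤ L := coordField_add_le X Y
  set F := IntermediateField.restrict hle
  have hF : F ≠ ⊤ := by
    intro h
    apply hne
    rw [← IntermediateField.lift_restrict hle]
    change IntermediateField.lift F = L
    rw [h, IntermediateField.lift_top]
  obtain ⟨σ, hσF, hσ⟩ : ∃ σ ∈ F.fixingSubgroup, σ ≠ 1 := by
    by_contra! h
    have h1 : F.fixingSubgroup = ⊥ := (Subgroup.eq_bot_iff_forall _).mpr h
    have h2 := InfiniteGalois.fixedField_fixingSubgroup F
    rw [h1, IntermediateField.fixedField_bot] at h2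
    exact hF h2.symm
  let τ : Gal(Ω/K) := σ.liftNormal Ω
  have hτ : ∀ x : L, τ x = σ x := fun x => σ.liftNormal_commutes Ω x
  have hXY : pointMap (τ : Ω →ₐ[K] Ω) (X + Y) = X + Y := by
    refine (baseChange_eq_self_iff _ _).mpr fun x hx => ?_
    have h1 : σ ⟨x, hle hx⟩ = ⟨x, hle hx⟩ :=
      (IntermediateField.mem_fixingSubgroup_iff F σ).mp hσF ⟨x, hle hx⟩
        ((IntermediateField.mem_restrict hle _).mpr hx)
    exact (hτ ⟨x, hle hx⟩).trans (congrArg Subtype.val h1)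
  set T := -X + pointMap (τ : Ω →ₐ[K] Ω) X with hTdef
  have hX : pointMap (τ : Ω →ₐ[K] Ω) X = X + T := (add_neg_cancel_left X _).symm
  rw [map_add, hX, add_assoc] at hXY
  have hY : pointMap (τ : Ω →ₐ[K] Ω) Y = -T + Y :=
    eq_neg_add_of_add_eq (add_left_cancel hXY)
  have hTY : T = Y + -pointMap (τ : Ω →ₐ[K] Ω) Y := by
    rw [hY, neg_add_rev, neg_neg, add_neg_cancel_left]
  have hT1 : coordField T ≤ coordField X :=
    (coordField_add_le _ _).trans (sup_le (coordField_neg_le X)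
      (coordField_baseChange_algEquiv τ X).le)
  have hT2 : coordField T ≤ coordField Y := by
    rw [hTY]
    exact (coordField_add_le _ _).trans (sup_le le_rfl
      ((coordField_neg_le _).trans (coordField_baseChange_algEquiv τ Y).le))
  have hTbot : coordField T ≤ ⊥ := hinf ▸ le_inf hT1 hT2
  have hTfix : pointMap (τ : Ω →ₐ[K] Ω) T = T := by
    refine (baseChange_eq_self_iff _ _).mpr fun x hx => ?_
    obtain ⟨c, rfl⟩ := IntermediateField.mem_bot.mp (hTbot hx)
    exact τ.commutes c
  refine ⟨τ, T, hX, fun hT0 => hσ ?_, hTbot, exponent_nsmul_eq_zero τ X T le_rfl hTfix hX, ?_⟩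
  · rw [hT0, add_zero] at hX
    rw [hT0, neg_zero, zero_add] at hY
    have hfix : τ ∈ L.fixingSubgroup := by
      rw [IntermediateField.fixingSubgroup_sup]
      exact ⟨(IntermediateField.mem_fixingSubgroup_iff _ _).mpr
          ((baseChange_eq_self_iff _ X).mp hX),
        (IntermediateField.mem_fixingSubgroup_iff _ _).mpr ((baseChange_eq_self_iff _ Y).mp hY)⟩
    ext x
    rw [← hτ]
    exact (IntermediateField.mem_fixingSubgroup_iff _ _).mp hfix x x.2
  · have hY' : pointMap (τ : Ω →ₐ[K] Ω) (-Y) = -Y + T := by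
      rw [map_neg, hY, neg_add_rev, neg_neg]
    exact exponent_nsmul_eq_zero τ (-Y) T (coordField_neg_le Y) hTfix hY'

lemma inf_eq_bot_of_finrank_prime {p : ℕ} (hp : p.Prime) {L₁ L₂ : IntermediateField K Ω}
    (h : L₁ ≠ L₂) (h₁ : finrank K L₁ = p) (h₂ : finrank K L₂ = p) : L₁ ⊓ L₂ = ⊥ := by
  have : FiniteDimensional K L₁ := FiniteDimensional.of_finrank_pos (h₁ ▸ hp.pos)
  have : FiniteDimensional K L₂ := FiniteDimensional.of_finrank_pos (h₂ ▸ hp.pos)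
  have hd : finrank K ↥(L₁ ⊓ L₂) ∣ p :=
    h₁ ▸ IntermediateField.finrank_dvd_of_le_right (inf_le_left : L₁ ⊓ L₂ ≤ L₁)
  rcases (Nat.dvd_prime hp).mp hd with h3 | h3
  · exact IntermediateField.finrank_eq_one_iff.mp h3
  · refine absurd ?_ h
    rw [← IntermediateField.eq_of_le_of_finrank_eq (inf_le_left : L₁ ⊓ L₂ ≤ L₁) (h3.trans h₁.symm)]
    exact IntermediateField.eq_of_le_of_finrank_eq (inf_le_right : L₁ ⊓ L₂ ≤ L₂)
      (h3.trans h₂.symm)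

end Compositum

end

end NewPoint

end

/-! ### New points -/

/-- An abelian variety over a field `K` is a proper geometrically integral group scheme over `K`
(such a group scheme is automatically smooth and commutative); the elliptic curves over `K` are
those of dimension one. -/
theorem proposition3p6 {K : Type u} [Field K] {Kbar : Type u} [Field Kbar] [Algebra K Kbar]
    [IsAlgClosure K Kbar]
    (E : Over (Spec (.of K))) [GrpObj E] [IsProper E.hom] [GeometricallyIntegral E.hom] :
    (∀ (L₁ L₂ : IntermediateField K Kbar), ¬ L₁ ≤ L₂ → ¬ L₂ ≤ L₁ →
      ∀ (P : NewPoint.Points E L₁) (Q : NewPoint.Points E L₂),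
        NewPoint.IsNew P → NewPoint.IsNew Q →
        (¬ IntermediateField.lift (NewPoint.coordField (NewPoint.addCompositum P Q)) ≤ L₁ ∧
          ¬ IntermediateField.lift (NewPoint.coordField (NewPoint.addCompositum P Q)) ≤ L₂) ∧
        (L₁.LinearDisjoint L₂ →
          max (Module.rank K L₁) (Module.rank K L₂) ≤
            Module.rank K (NewPoint.coordField (NewPoint.addCompositum P Q))) ∧
        (IsGalois K L₁ → IsGalois K L₂ → L₁.LinearDisjoint L₂ →
          ∀ e : ℕ, e = Nat.gcd (Monoid.exponent Gal(L₁/K)) (Monoid.exponent Gal(L₂/K)) →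
            (e = 1 → NewPoint.NoTorsionDividing E e) ∧
            (NewPoint.NoTorsionDividing E e →
              NewPoint.IsNew (NewPoint.addCompositum P Q)))) ∧
    (∀ (_ : NumberField K) (p : ℕ), p.Prime → (∃ T : NewPoint.Points E K, addOrderOf T = p) →
      ∃ S : Set (IntermediateField K Kbar), S.Finite ∧ (∀ M ∈ S, IsGalois K M) ∧
        ∀ (L₁ L₂ : IntermediateField K Kbar), L₁ ≠ L₂ →
          IsGalois K L₁ → IsCyclic Gal(L₁/K) → Module.finrank K L₁ = p →
          IsGalois K L₂ → IsCyclic Gal(L₂/K) → Module.finrank K L₂ = p →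
          L₁ ∉ S → L₂ ∉ S →
          ∀ (P : NewPoint.Points E L₁) (Q : NewPoint.Points E L₂),
            NewPoint.IsNew P → NewPoint.IsNew Q →
            NewPoint.IsNew (NewPoint.addCompositum P Q)) := by
  have : Algebra.IsAlgebraic K Kbar := IsAlgClosure.isAlgebraic
  refine ⟨fun L₁ L₂ h₁₂ h₂₁ P Q hP hQ => ?_, fun _ p hp _ => ?_⟩
  · rw [NewPoint.isNew_iff_coordField_baseChange_val] at hP hQ
    rw [NewPoint.isNew_iff_coordField_baseChange_val, ← NewPoint.coordField_baseChange_val,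
      NewPoint.baseChange_val_addCompositum]
    have hrank : Module.rank K (NewPoint.coordField (NewPoint.addCompositum P Q)) =
        Module.rank K (NewPoint.coordField
          (NewPoint.baseChange (L₁ ⊔ L₂).val (NewPoint.addCompositum P Q))) := by
      rw [NewPoint.coordField_baseChange_val]
      exact (IntermediateField.liftAlgEquiv _).toLinearEquiv.rank_eq
    rw [hrank, NewPoint.baseChange_val_addCompositum]
    set X : NewPoint.RingPoints E Kbar := NewPoint.baseChange L₁.val P
    set Y : NewPoint.RingPoints E Kbar := NewPoint.baseChange L₂.val Q
    have hX := NewPoint.coordField_le_of_add' X Y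
    have hY := NewPoint.coordField_le_of_add X Y
    rw [hP, hQ] at hX hY
    refine ⟨⟨fun h => h₂₁ (hY.trans (sup_le le_rfl h)), fun h => h₁₂ (hX.trans (sup_le le_rfl h))⟩,
      fun hdis => max_le (NewPoint.rank_le_of_le_sup hdis.symm hX)
        (NewPoint.rank_le_of_le_sup hdis hY), ?_⟩
    intro hG₁ hG₂ hdis e he
    refine ⟨fun he1 T hT => ?_, fun hno => ?_⟩
    · rw [he1, Nat.dvd_one] at hT
      exact AddMonoid.addOrderOf_eq_one_iff.mp hT
    · by_contra hne
      obtain ⟨τ, T, -, hT0, hTbot, hT1, hT2⟩ :=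
        NewPoint.exists_translation_of_coordField_add_ne hP hQ hdis.inf_eq_bot hne
      obtain ⟨T₀, rfl⟩ := NewPoint.exists_pointMap_ofId_eq T hTbot
      refine hT0 ?_
      rw [hno T₀ ?_, map_zero]
      rw [he]
      refine Nat.dvd_gcd ?_ ?_ <;> refine addOrderOf_dvd_of_nsmul_eq_zero
        (NewPoint.pointMap_injective (Algebra.ofId K Kbar) (algebraMap K Kbar).injective ?_)
      · rwa [map_nsmul, map_zero]
      · rwa [map_nsmul, map_zero]
  · have hfin := NewPoint.finite_setOf_inertia_moves (Ω := Kbar) E hp.ne_zero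
    refine ⟨_, NewPoint.finite_isGalois_of_inertia_trivial (Ω := Kbar) hp hfin.toFinset,
      fun M hM => hM.1, ?_⟩
    intro L₁ L₂ hne hG₁ _ hL₁ hG₂ _ hL₂ hS _ P Q hP hQ
    rw [NewPoint.isNew_iff_coordField_baseChange_val] at hP hQ
    rw [NewPoint.isNew_iff_coordField_baseChange_val, NewPoint.baseChange_val_addCompositum]
    by_contra hnew
    obtain ⟨τ, T, hτ, hT0, -, hT, -⟩ := NewPoint.exists_translation_of_coordField_add_ne hP hQ
      (NewPoint.inf_eq_bot_of_finrank_prime hp hne hL₁ hL₂) hnew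
    have : FiniteDimensional K L₁ := FiniteDimensional.of_finrank_pos (hL₁ ▸ hp.pos)
    have : FiniteDimensional ℚ L₁ := FiniteDimensional.trans ℚ K L₁
    have hcard : Nat.card Gal(L₁/K) = p := by rw [IsGalois.card_aut_eq_finrank, hL₁]
    have hpT : p • T = 0 := by
      obtain ⟨m, hm⟩ := hcard ▸ Group.exponent_dvd_nat_card (G := Gal(L₁/K))
      rw [hm, mul_nsmul, hT, nsmul_zero]
    set ρ : Gal(L₁/K) := AlgEquiv.restrictNormalHom L₁ τ
    have hρ : (τ : Kbar →ₐ[K] Kbar).comp L₁.val = L₁.val.comp (ρ : L₁ →ₐ[K] L₁) := by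
      ext x
      exact (AlgEquiv.restrictNormalHom_apply L₁ τ x).symm
    have hinj := NewPoint.pointMap_injective (E := E) L₁.val L₁.val.injective
    have hρP : NewPoint.pointMap L₁.val (-P + NewPoint.pointMap (ρ : L₁ →ₐ[K] L₁) P) = T := by
      rw [map_add, map_neg, ← NewPoint.pointMap_comp, ← hρ, NewPoint.pointMap_comp]
      exact neg_add_eq_of_eq_add hτ
    have hmove : NewPoint.pointMap (ρ : L₁ →ₐ[K] L₁) P ≠ P := by
      intro h
      rw [h, neg_add_cancel, map_zero] at hρP
      exact hT0 hρP.symm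
    -- It suffices that inertia is trivial outside the primes where it can move points by torsion.
    refine hS ⟨hG₁, hL₁, fun w hw σ hσ => ?_⟩
    by_contra hσ1
    -- As `Gal(L₁/K)` has prime order, a nontrivial inertia group is everything.
    have hρσ : ρ ∈ Subgroup.zpowers σ := by
      have : Fact p.Prime := ⟨hp⟩
      exact mem_zpowers_of_prime_card hcard hσ1
    refine hw (hfin.mem_toFinset.mpr ⟨L₁, ⟨⟩, w, ρ, P, rfl, ?_, hinj ?_, hmove⟩)
    · exact (Subgroup.zpowers_le.mpr hσ) hρσ
    · rw [map_nsmul, hρP, hpT, map_zero]
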